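/- Let $j\ge 1$ be an integer and let $T\subset\mathbb{R}^2$ be the closed triangle with vertices $(0,0)$, $(1,0)$ and $(0,1)$. For a lattice $\Lambda$ in $\mathbb{R}^2$ (a discrete additive subgroup spanning $\mathbb{R}^2$), the family $T+\Lambda=\{T+v : v\in\Lambda\}$ is called a $j$-fold lattice covering of $\mathbb{R}^2$ with $T$ if every point of $\mathbb{R}^2$ belongs to at least $j$ of the sets $T+v$, $v\in\Lambda$. Its density is the lower density $$d_-(T+\Lambda)=\liminf_{l\to\infty}\frac{1}{|lI^2|}\sum_{v\in\Lambda,\ T+v\subset lI^2}|T+v|,\qquad I=[-1,1],$$ where $|\cdot|$ denotes area, and the $j$-fold lattice covering density $\vartheta_L^j(T)$ is the infimum of $d_-(T+\Lambda)$ over all lattices $\Lambda$ for which $T+\Lambda$ is a $j$-fold lattice covering of $\mathbb{R}^2$. Let $\Theta_L^j(T)$ be the collection of the lattices $\Lambda$ such that $T+\Lambda$ is a $j$-fold lattice covering of $\mathbb{R}^2$ whose density is equal to $\vartheta_L^j(T)$. Then a lattice $\Lambda$ is in $\Theta_L^j(T)$ if and only if there exists an integer $m$ such that $1\le m\le 2j+1$,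 $\gcd(m,2j+1)=\gcd(m+1,2j+1)=1$ and $\Lambda$ is generated by $\left(\frac{1}{2j+1},\frac{m}{2j+1}\right)$ and $(0,1)$. -/

import Mathlib

open MeasureTheory Filter

/-- The square `[-l, l] × [-l, l]`, that is `l I²` with `I = [-1, 1]`. -/
def centeredSquare (l : ℝ) : Set (ℝ × ℝ) :=
  Set.Icc (-l) l ×ˢ Set.Icc (-l) l

open Classical in
/-- The lower density of a family `F` of subsets of the plane with respect to a domain `D`:
the total area of the members of `F` contained in `D`, divided by the area of `D`. -/
noncomputable def lowerDensityOn {ι : Type*} (F : ι → Set (ℝ × ℝ)) (D : Set (ℝ × ℝ)) : ENNReal :=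
  (∑' i : ι, if F i ⊆ D then volume (F i) else 0) / volume D

/-- The lower density of a family `F` of subsets of the plane:
the lower limit of its lower densities with respect to the squares `l I²`, as `l → ∞`. -/
noncomputable def lowerDensity {ι : Type*} (F : ι → Set (ℝ × ℝ)) : ENNReal :=
  liminf (fun l : ℝ => lowerDensityOn F (centeredSquare l)) atTop

/-- A family of sets is a `j`-fold covering of the plane if every point of the plane belongs to
at least `j` members of the family. -/
def IsFoldCovering {ι : Type*} (j : ℕ) (F : ι → Set (ℝ × ℝ)) : Prop :=
  ∀ u : ℝ × ℝ, (j : ℕ∞) ≤ {i : ι | u ∈ F i}.encard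

/-- A lattice of the plane: a discrete additive subgroup that spans the plane over `ℝ`. -/
def IsPlaneLattice (Λ : Submodule ℤ (ℝ × ℝ)) : Prop :=
  ∃ _ : DiscreteTopology Λ, IsZLattice ℝ Λ

/-- The family `K + Λ` of the translates `K + v`, `v ∈ Λ`. -/
def latticeTranslates (K : Set (ℝ × ℝ)) (Λ : Submodule ℤ (ℝ × ℝ)) : Λ → Set (ℝ × ℝ) :=
  fun v => (fun x : ℝ × ℝ => x + (v : ℝ × ℝ)) '' K

/-- `K + Λ` is a `j`-fold lattice covering of the plane. -/
def IsFoldLatticeCovering (j : ℕ) (K : Set (ℝ × ℝ)) (Λ : Submodule ℤ (ℝ × ℝ)) : Prop :=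
  IsPlaneLattice Λ ∧ IsFoldCovering j (latticeTranslates K Λ)

/-- The `j`-fold lattice covering density of `K`: the infimum of the lower densities of the
`j`-fold lattice coverings of the plane with `K`. -/
noncomputable def latticeCoveringDensity (j : ℕ) (K : Set (ℝ × ℝ)) : ENNReal :=
  sInf {d : ENNReal | ∃ Λ : Submodule ℤ (ℝ × ℝ),
    IsFoldLatticeCovering j K Λ ∧ d = lowerDensity (latticeTranslates K Λ)}

/-- The collection of the lattices `Λ` for which `K + Λ` is a `j`-fold lattice covering of the
plane whose density is equal to the `j`-fold lattice covering density of `K`. -/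
def optimalCoveringLattices (j : ℕ) (K : Set (ℝ × ℝ)) : Set (Submodule ℤ (ℝ × ℝ)) :=
  {Λ | IsFoldLatticeCovering j K Λ ∧
    lowerDensity (latticeTranslates K Λ) = latticeCoveringDensity j K}

/-- The closed triangle with vertices `(0, 0)`, `(1, 0)` and `(0, 1)`. -/
def standardTriangle : Set (ℝ × ℝ) :=
  convexHull ℝ {((0 : ℝ), (0 : ℝ)), ((1 : ℝ), (0 : ℝ)), ((0 : ℝ), (1 : ℝ))}

/-! Put n = 2j + 1. Since T has area 1/2, the density of T + Λ is 1/(2 · covolume), so the task is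
to find the coverings of largest covolume. For the upper bound, order the plane by coordinate sum,
ties broken by the first coordinate (`sumKey`). In every coset u + Λ keep the j smallest points of
the quadrant x > 0, y ≥ 0. The points kept form `stair Λ j`: the rank of w in its coset is the
number of positive lattice points v with w - v still in the quadrant. Each coset contributes exactly
j points, so the area is j · covolume (`volume_stair`). Covering forces the staircase into x + y ≤ 1
(`stair_sum_le_one`), and it descends at no more than 2j abscissas (`exists_stair_steps`). It
therefore lies in n rectangles inscribed in T, of total area at most 1/2 - 1/(2n) = j/n
(`sum_rectangles_eq`), whence covolume ≤ 1/n. If covolume = 1/n, all steps have length 1/n, the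
staircase is `regularStair n`, and some lattice vector has first coordinate 1/n. Sliding this
staircase horizontally, with the number of lattice points in it fixed at j, forces nx to be an
integer for lattice points in a strip (`strip_integral`), and then for all of Λ. The affine
symmetries of T give the same for y, and lattice vectors with y = 1/n and x + y = -1/n. A sublattice
of (1/n)ℤ² with these vectors and covolume 1/n has the stated generators; the last two vectors yield
the coprimality conditions. Conversely, under coprimality a residue count
(`le_card_triangle_residue`) shows that the lattice covers j-fold. -/

/-! ### Elements of small rank in a linear order -/

theorem encard_rank_lt_le {α : Type*} [LinearOrder α] {X : Set α}
    (hX : ∀ x ∈ X, (X ∩ Set.Iio x).Finite) (j : ℕ) :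
    {x ∈ X | (X ∩ Set.Iio x).ncard < j}.encard ≤ j := by
  have hinj : Set.InjOn (fun x => (X ∩ Set.Iio x).ncard)
      {x ∈ X | (X ∩ Set.Iio x).ncard < j} := by
    have key : ∀ x ∈ X, ∀ y ∈ X, x < y → (X ∩ Set.Iio x).ncard < (X ∩ Set.Iio y).ncard := by
      intro x hx y hy hxy
      refine Set.ncard_lt_ncard ⟨fun z hz => ⟨hz.1, lt_trans hz.2 hxy⟩, fun h => ?_⟩ (hX y hy)
      exact lt_irrefl x (h ⟨hx, hxy⟩).2
    intro x hx y hy hxy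
    rcases lt_trichotomy x y with h | h | h
    · exact absurd hxy (key x hx.1 y hy.1 h).ne
    · exact h
    · exact absurd hxy (key y hy.1 x hx.1 h).ne'
  rw [← hinj.encard_image]
  calc _ ≤ (Finset.range j : Set ℕ).encard := by
        apply Set.encard_le_encard
        rintro _ ⟨x, hx, rfl⟩
        simpa using hx.2
    _ = j := by rw [Set.encard_coe_eq_coe_finsetCard, Finset.card_range]

/-- Every rank k < j is attained. At most k elements have rank below k, so some element has rank at
least k; one of least such rank has only elements of rank below k beneath it, so its rank is k. -/
theorem encard_rank_lt_eq {α : Type*} [LinearOrder α] {X : Set α}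
    (hX : ∀ x ∈ X, (X ∩ Set.Iio x).Finite) {j : ℕ} (hj : (j : ℕ∞) ≤ X.encard) :
    {x ∈ X | (X ∩ Set.Iio x).ncard < j}.encard = j := by
  apply le_antisymm (encard_rank_lt_le hX j)
  have hsurj : (Finset.range j : Set ℕ) ⊆
      (fun x => (X ∩ Set.Iio x).ncard) '' {x ∈ X | (X ∩ Set.Iio x).ncard < j} := by
    intro k hk
    have hk : k < j := by simpa using hk
    have hex : ∃ r, ∃ x ∈ X, k ≤ (X ∩ Set.Iio x).ncard ∧ (X ∩ Set.Iio x).ncard = r := by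
      by_contra hno
      push Not at hno
      have hsub : X ⊆ {x ∈ X | (X ∩ Set.Iio x).ncard < k} := by
        intro x hx
        refine ⟨hx, ?_⟩
        by_contra hlt
        exact hno _ x hx (not_lt.mp hlt) rfl
      have := (hj.trans (Set.encard_le_encard hsub)).trans (encard_rank_lt_le hX k)
      exact absurd (by exact_mod_cast this) (not_le.mpr hk)
    classical
    obtain ⟨x, hx, hkx, hr⟩ := Nat.find_spec hex
    have hsub : X ∩ Set.Iio x ⊆ {y ∈ X | (X ∩ Set.Iio y).ncard < k} := by
      rintro y ⟨hy, hyx⟩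
      refine ⟨hy, ?_⟩
      by_contra hlt
      have hlt' : (X ∩ Set.Iio y).ncard < (X ∩ Set.Iio x).ncard := by
        refine Set.ncard_lt_ncard ⟨fun z hz => ⟨hz.1, lt_trans hz.2 hyx⟩, fun h => ?_⟩ (hX x hx)
        exact lt_irrefl y (h ⟨hy, hyx⟩).2
      exact Nat.find_min hex (hr ▸ hlt') ⟨y, hy, not_lt.mp hlt, rfl⟩
    have hle : (X ∩ Set.Iio x).ncard ≤ k := by
      have := (Set.encard_le_encard hsub).trans (encard_rank_lt_le hX k)
      rw [← (hX x hx).cast_ncard_eq] at this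
      exact_mod_cast this
    have heq : (X ∩ Set.Iio x).ncard = k := le_antisymm hle hkx
    exact ⟨x, ⟨hx, heq ▸ hk⟩, heq⟩
  calc (j : ℕ∞) = (Finset.range j : Set ℕ).encard := by
        rw [Set.encard_coe_eq_coe_finsetCard, Finset.card_range]
    _ ≤ _ := (Set.encard_le_encard hsurj).trans (Set.encard_image_le _ _)

/-! ### The triangle, and coverings as lattice point counts -/

theorem mem_standardTriangle {p : ℝ × ℝ} :
    p ∈ standardTriangle ↔ 0 ≤ p.1 ∧ 0 ≤ p.2 ∧ p.1 + p.2 ≤ 1 := by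
  unfold standardTriangle
  constructor
  · intro h
    have hc : Convex ℝ {p : ℝ × ℝ | 0 ≤ p.1 ∧ 0 ≤ p.2 ∧ p.1 + p.2 ≤ 1} := by
      rintro ⟨a, b⟩ ⟨h1, h2, h3⟩ ⟨c, d⟩ ⟨h4, h5, h6⟩ s t hs ht hst
      simp only [Set.mem_ofPred_eq, Prod.smul_mk, smul_eq_mul, Prod.mk_add_mk] at *
      refine ⟨by positivity, by positivity, ?_⟩
      nlinarith
    refine convexHull_min ?_ hc h
    rintro q (rfl | rfl | rfl) <;> norm_num
  · rintro ⟨h1, h2, h3⟩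
    rw [convexHull_insert (by simp), convexHull_pair]
    simp only [convexJoin, Set.mem_iUnion, Set.mem_singleton_iff]
    rcases eq_or_lt_of_le (add_nonneg h1 h2) with h0 | h0
    · refine ⟨(0, 0), rfl, (1, 0), left_mem_segment _ _ _, ?_⟩
      have : p = (0, 0) := Prod.ext (by simp; linarith) (by simp; linarith)
      rw [this]
      exact left_mem_segment _ _ _
    · refine ⟨(0, 0), rfl, (p.1 / (p.1 + p.2), p.2 / (p.1 + p.2)), ?_, ?_⟩
      · refine ⟨p.1 / (p.1 + p.2), p.2 / (p.1 + p.2), by positivity, by positivity, ?_, ?_⟩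
        · field_simp
        · simp
      · refine ⟨1 - (p.1 + p.2), p.1 + p.2, by linarith, h0.le, by ring, ?_⟩
        ext <;> simp <;> field_simp

theorem mem_latticeTranslates_standardTriangle {Λ : Submodule ℤ (ℝ × ℝ)} {v : Λ} {u : ℝ × ℝ} :
    u ∈ latticeTranslates standardTriangle Λ v ↔
      (v : ℝ × ℝ).1 ≤ u.1 ∧ (v : ℝ × ℝ).2 ≤ u.2 ∧
        u.1 + u.2 ≤ (v : ℝ × ℝ).1 + (v : ℝ × ℝ).2 + 1 := by
  unfold latticeTranslates
  constructor
  · rintro ⟨x, hx, rfl⟩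
    rw [mem_standardTriangle] at hx
    simp only [Prod.fst_add, Prod.snd_add]
    exact ⟨by linarith [hx.1], by linarith [hx.2.1], by linarith [hx.2.2]⟩
  · rintro ⟨h1, h2, h3⟩
    refine ⟨u - v, mem_standardTriangle.mpr ?_, by simp⟩
    simp only [Prod.fst_sub, Prod.snd_sub]
    exact ⟨by linarith, by linarith, by linarith⟩

/-- A covering by triangles, expressed by counting lattice points. -/
theorem isFoldCovering_standardTriangle_iff {j : ℕ} {Λ : Submodule ℤ (ℝ × ℝ)} :
    IsFoldCovering j (latticeTranslates standardTriangle Λ) ↔ ∀ u : ℝ × ℝ,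
      (j : ℕ∞) ≤ {v : ℝ × ℝ | v ∈ Λ ∧ v.1 ≤ u.1 ∧ v.2 ≤ u.2 ∧
        u.1 + u.2 ≤ v.1 + v.2 + 1}.encard := by
  unfold IsFoldCovering
  refine forall_congr' fun u => ?_
  simp only [mem_latticeTranslates_standardTriangle]
  have : {v : ℝ × ℝ | v ∈ Λ ∧ v.1 ≤ u.1 ∧ v.2 ≤ u.2 ∧ u.1 + u.2 ≤ v.1 + v.2 + 1} =
      Subtype.val '' {v : Λ | (v : ℝ × ℝ).1 ≤ u.1 ∧ (v : ℝ × ℝ).2 ≤ u.2 ∧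
        u.1 + u.2 ≤ (v : ℝ × ℝ).1 + (v : ℝ × ℝ).2 + 1} := by
    ext v
    simp only [Set.mem_ofPred_eq, Set.mem_image, Subtype.exists, exists_and_right, exists_eq_right,
      exists_prop]
    tauto
  rw [this, Subtype.val_injective.encard_image]

theorem lattice_inter_finite (Λ : Submodule ℤ (ℝ × ℝ)) [DiscreteTopology Λ] {K : Set (ℝ × ℝ)}
    (hK : Bornology.IsBounded K) : {v | v ∈ Λ ∧ v ∈ K}.Finite := by
  have : {v | v ∈ Λ ∧ v ∈ K} = K ∩ (Λ.toAddSubgroup : Set (ℝ × ℝ)) := by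
    ext v; simp [and_comm]
  rw [this]
  have : DiscreteTopology Λ.toAddSubgroup := ‹_›
  exact Metric.finite_isBounded_inter_isClosed DiscreteTopology.isDiscrete hK inferInstance

theorem lattice_box_finite (Λ : Submodule ℤ (ℝ × ℝ)) [DiscreteTopology Λ] (a b c d : ℝ) :
    {v : ℝ × ℝ | v ∈ Λ ∧ a ≤ v.1 ∧ v.1 ≤ b ∧ c ≤ v.2 ∧ v.2 ≤ d}.Finite := by
  refine (lattice_inter_finite Λ ((Metric.isBounded_Icc a b).prod (Metric.isBounded_Icc c d))).subset
    ?_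
  rintro v ⟨h, h1, h2, h3, h4⟩
  exact ⟨h, ⟨h1, h2⟩, ⟨h3, h4⟩⟩

/-! ### The staircase of a covering lattice -/

/-- Sum of the coordinates, with ties resolved by the first coordinate. -/
def sumKey (p : ℝ × ℝ) : ℝ ×ₗ ℝ := toLex (p.1 + p.2, p.1)

theorem sumKey_injective : Function.Injective sumKey := by
  rintro ⟨a, b⟩ ⟨c, d⟩ h
  have h := toLex.injective h
  simp only [Prod.mk.injEq] at h
  ext
  · exact h.2
  · simp; linarith

theorem sumKey_lt_iff {p q : ℝ × ℝ} :
    sumKey p < sumKey q ↔ p.1 + p.2 < q.1 + q.2 ∨ p.1 + p.2 = q.1 + q.2 ∧ p.1 < q.1 :=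
  Prod.Lex.toLex_lt_toLex

theorem sumKey_pos_sub {p q : ℝ × ℝ} : sumKey 0 < sumKey (q - p) ↔ sumKey p < sumKey q := by
  simp only [sumKey_lt_iff, Prod.fst_zero, Prod.snd_zero, Prod.fst_sub, Prod.snd_sub]
  constructor <;> rintro (h | ⟨h, h'⟩)
  · left; linarith
  · right; constructor <;> linarith
  · left; linarith
  · right; constructor <;> linarith

theorem sumKey_pos_sum_nonneg {p : ℝ × ℝ} (h : sumKey 0 < sumKey p) : 0 ≤ p.1 + p.2 := by
  rcases sumKey_lt_iff.mp h with h | h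
  · simpa using h.le
  · simpa using h.1.le

/-- The positive lattice points strictly to the left of `w` and not above `w`. -/
def lowerPoints (Λ : Submodule ℤ (ℝ × ℝ)) (w : ℝ × ℝ) : Set (ℝ × ℝ) :=
  {v | v ∈ Λ ∧ sumKey 0 < sumKey v ∧ v.1 < w.1 ∧ v.2 ≤ w.2}

/-- The staircase region cut out of the quadrant by the positive lattice points. -/
def stair (Λ : Submodule ℤ (ℝ × ℝ)) (j : ℕ) : Set (ℝ × ℝ) :=
  {w | 0 < w.1 ∧ 0 ≤ w.2 ∧ (lowerPoints Λ w).ncard < j}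

theorem lowerPoints_finite (Λ : Submodule ℤ (ℝ × ℝ)) [DiscreteTopology Λ] (w : ℝ × ℝ) :
    (lowerPoints Λ w).Finite := by
  refine (lattice_box_finite Λ (-w.2) w.1 (-w.1) w.2).subset ?_
  rintro v ⟨h1, h2, h3, h4⟩
  have := sumKey_pos_sum_nonneg h2
  exact ⟨h1, by linarith, by linarith, by linarith, by linarith⟩

theorem lowerPoints_mono (Λ : Submodule ℤ (ℝ × ℝ)) {w w' : ℝ × ℝ} (h1 : w.1 ≤ w'.1)
    (h2 : w.2 ≤ w'.2) : lowerPoints Λ w ⊆ lowerPoints Λ w' := by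
  rintro v ⟨a, b, c, d⟩
  exact ⟨a, b, by linarith, by linarith⟩

section Covering

variable {Λ : Submodule ℤ (ℝ × ℝ)} {j : ℕ}

/-- Subtraction from w matches the points of `lowerPoints Λ w` with the smaller points of the coset
in the quadrant, so membership in the staircase means rank below j. The covering hypothesis ensures
that the quadrant holds at least j points of each coset. -/
theorem encard_translate_stair [DiscreteTopology Λ]
    (hcov : IsFoldCovering j (latticeTranslates standardTriangle Λ)) (u : ℝ × ℝ) :
    {v : ℝ × ℝ | v ∈ Λ ∧ u + v ∈ stair Λ j}.encard = j := by
  set W : Set (ℝ × ℝ) := {w | w - u ∈ Λ ∧ 0 < w.1 ∧ 0 ≤ w.2} with hW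
  set X := sumKey '' W with hX
  have hseg : ∀ w ∈ W, X ∩ Set.Iio (sumKey w) = (fun v => sumKey (w - v)) '' lowerPoints Λ w := by
    intro w hw
    ext x
    constructor
    · rintro ⟨⟨w', hw', rfl⟩, hlt⟩
      refine ⟨w - w', ⟨?_, sumKey_pos_sub.mpr hlt, ?_, ?_⟩, by simp⟩
      · simpa using Λ.sub_mem hw.1 hw'.1
      · simpa using hw'.2.1
      · simpa using hw'.2.2
    · rintro ⟨v, ⟨h1, h2, h3, h4⟩, rfl⟩
      refine ⟨⟨w - v, ⟨?_, by simpa using h3, by simpa using h4⟩, rfl⟩, ?_⟩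
      · have := Λ.sub_mem hw.1 h1
        rwa [sub_right_comm] at this
      · show sumKey (w - v) < sumKey w
        rw [← sumKey_pos_sub]
        simpa using h2
  have hinj : ∀ w : ℝ × ℝ, Function.Injective (fun v => sumKey (w - v)) :=
    fun w => sumKey_injective.comp sub_right_injective
  have hXfin : ∀ x ∈ X, (X ∩ Set.Iio x).Finite := by
    rintro _ ⟨w, hw, rfl⟩
    rw [hseg w hw]
    exact (lowerPoints_finite Λ w).image _
  have hrank : ∀ w ∈ W, (X ∩ Set.Iio (sumKey w)).ncard = (lowerPoints Λ w).ncard := by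
    intro w hw
    rw [hseg w hw, Set.ncard_image_of_injective _ (hinj w)]
  have hcard : (j : ℕ∞) ≤ X.encard := by
    rw [hX, sumKey_injective.encard_image]
    -- The shift by (1, 0) makes the first coordinates of u - v strictly positive.
    refine ((isFoldCovering_standardTriangle_iff.mp hcov) (u - (1, 0))).trans ?_
    have hi : Function.Injective (fun v : ℝ × ℝ => u - v) := sub_right_injective
    rw [← hi.encard_image]
    apply Set.encard_le_encard
    rintro _ ⟨v, ⟨h1, h2, h3, -⟩, rfl⟩
    simp only [Prod.fst_sub, Prod.snd_sub, sub_zero] at h2 h3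
    refine ⟨?_, ?_, ?_⟩
    · simpa using h1
    · simp only [Prod.fst_sub]; linarith
    · simp only [Prod.snd_sub]; linarith
  rw [← encard_rank_lt_eq hXfin hcard]
  have himg : {x ∈ X | (X ∩ Set.Iio x).ncard < j} =
      (fun v => sumKey (u + v)) '' {v : ℝ × ℝ | v ∈ Λ ∧ u + v ∈ stair Λ j} := by
    ext x
    constructor
    · rintro ⟨⟨w, hw, rfl⟩, hr⟩
      rw [hrank w hw] at hr
      refine ⟨w - u, ⟨hw.1, ?_⟩, by simp⟩
      rw [add_sub_cancel]
      exact ⟨hw.2.1, hw.2.2, hr⟩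
    · rintro ⟨v, ⟨hv, h1, h2, h3⟩, rfl⟩
      have hw : u + v ∈ W := ⟨by simpa using hv, h1, h2⟩
      exact ⟨⟨u + v, hw, rfl⟩, by rwa [hrank _ hw]⟩
  have hi : Function.Injective (fun v => sumKey (u + v)) :=
    sumKey_injective.comp (add_right_injective u)
  rw [himg, hi.encard_image]

/-- If w lay beyond the hypotenuse, the j lattice points supplied by covering at a point slightly to
the left of w would all have positive coordinate sum, hence be lower points of w. -/
theorem stair_sum_le_one [DiscreteTopology Λ]
    (hcov : IsFoldCovering j (latticeTranslates standardTriangle Λ)) {w : ℝ × ℝ}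
    (hw : w ∈ stair Λ j) : w.1 + w.2 ≤ 1 := by
  by_contra hlt
  push Not at hlt
  obtain ⟨ε, hε, hε'⟩ : ∃ ε > 0, ε < w.1 + w.2 - 1 :=
    exists_between (by linarith : (0:ℝ) < w.1 + w.2 - 1)
  have h := (isFoldCovering_standardTriangle_iff.mp hcov) (w - (ε, 0))
  have hsub : {v : ℝ × ℝ | v ∈ Λ ∧ v.1 ≤ (w - (ε, 0)).1 ∧ v.2 ≤ (w - (ε, 0)).2 ∧
      (w - (ε, 0)).1 + (w - (ε, 0)).2 ≤ v.1 + v.2 + 1} ⊆ lowerPoints Λ w := by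
    rintro v ⟨h1, h2, h3, h4⟩
    simp only [Prod.fst_sub, Prod.snd_sub, sub_zero] at h2 h3 h4
    refine ⟨h1, sumKey_lt_iff.mpr (Or.inl ?_), by linarith, by linarith⟩
    simp only [Prod.fst_zero, Prod.snd_zero]
    linarith
  have h := h.trans (Set.encard_le_encard hsub)
  rw [← (lowerPoints_finite Λ w).cast_ncard_eq] at h
  have h : j ≤ (lowerPoints Λ w).ncard := by exact_mod_cast h
  exact absurd hw.2.2 (not_lt.mpr h)

/-- The abscissas at which the staircase may go down. -/
theorem exists_stair_steps [DiscreteTopology Λ]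
    (hcov : IsFoldCovering j (latticeTranslates standardTriangle Λ)) :
    ∃ E : Finset ℝ, E.card ≤ 2 * j ∧ (∀ v ∈ Λ, v ∈ stair Λ j → v.1 ∈ E) ∧
      (∀ e ∈ E, ∃ v ∈ Λ, v.1 = e) ∧
      ∀ x x' y : ℝ, (x, y) ∈ stair Λ j → x < x' → (x', y) ∉ stair Λ j →
        ∃ e ∈ E, x ≤ e ∧ e < x' := by
  set X : Set ℝ := {x | ∃ v ∈ Λ, sumKey 0 < sumKey v ∧ v.2 < 0 ∧ v.1 = x} with hX
  have hseg : ∀ x : ℝ, X ∩ Set.Iio x ⊆ Prod.fst '' (lowerPoints Λ (x, 0)) := by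
    rintro x _ ⟨⟨v, hv, hv0, hv2, rfl⟩, hlt⟩
    exact ⟨v, ⟨hv, hv0, hlt, hv2.le⟩, rfl⟩
  have hXfin : ∀ x ∈ X, (X ∩ Set.Iio x).Finite := fun x _ =>
    ((lowerPoints_finite Λ (x, 0)).image _).subset (hseg x)
  -- A descent is caused by a positive lattice point: if it is not below the axis it lies in the
  -- staircase itself (at most j of these); if below, its abscissa is among the j smallest of that
  -- kind.
  set E₁ : Set ℝ := Prod.fst '' {v : ℝ × ℝ | v ∈ Λ ∧ v ∈ stair Λ j} with hE₁
  set E₂ : Set ℝ := {x ∈ X | (X ∩ Set.Iio x).ncard < j} with hE₂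
  have hc₁ : E₁.encard ≤ j := by
    refine (Set.encard_image_le _ _).trans (le_of_eq ?_)
    simpa using encard_translate_stair hcov 0
  have hc₂ : E₂.encard ≤ j := encard_rank_lt_le hXfin j
  have hc : (E₁ ∪ E₂).encard ≤ (2 * j : ℕ) := by
    refine (Set.encard_union_le _ _).trans ((add_le_add hc₁ hc₂).trans (le_of_eq ?_))
    push_cast; ring
  have hfin : (E₁ ∪ E₂).Finite := Set.finite_of_encard_le_coe hc
  refine ⟨hfin.toFinset, ?_, ?_, ?_, ?_⟩
  · rw [hfin.encard_eq_coe_toFinset_card] at hc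
    exact_mod_cast hc
  · intro v hv hvs
    simp only [Set.Finite.mem_toFinset]
    exact Or.inl ⟨v, ⟨hv, hvs⟩, rfl⟩
  · intro e he
    simp only [Set.Finite.mem_toFinset] at he
    rcases he with ⟨v, ⟨hv, -⟩, rfl⟩ | ⟨⟨v, hv, -, -, rfl⟩, -⟩
    · exact ⟨v, hv, rfl⟩
    · exact ⟨v, hv, rfl⟩
  · intro x x' y hxy hlt hnot
    obtain ⟨hx, hy, hN⟩ := hxy
    simp only at hx hy
    set P : Set (ℝ × ℝ) := {v ∈ lowerPoints Λ (x', y) | x ≤ v.1} with hP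
    have hPfin : P.Finite := (lowerPoints_finite Λ _).subset fun v hv => hv.1
    have hPne : P.Nonempty := by
      by_contra hno
      rw [Set.not_nonempty_iff_eq_empty] at hno
      have hsub : lowerPoints Λ (x', y) ⊆ lowerPoints Λ (x, y) := by
        intro v hv
        refine ⟨hv.1, hv.2.1, ?_, hv.2.2.2⟩
        by_contra hxv
        have : v ∈ P := ⟨hv, not_lt.mp hxv⟩
        rw [hno] at this
        exact this
      exact hnot ⟨hx.trans hlt, hy,
        (Set.ncard_le_ncard hsub (lowerPoints_finite Λ _)).trans_lt hN⟩
    -- Choosing v leftmost, no lower points are gained between abscissas x and `v.1`, so fewer than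
    -- j precede v.
    obtain ⟨v, ⟨⟨hvΛ, hv0, hv1, hv2⟩, hvx⟩, hmin⟩ := Set.exists_min_image P Prod.fst hPfin hPne
    simp only at hv1 hv2
    have hleft : lowerPoints Λ (v.1, y) ⊆ lowerPoints Λ (x, y) := by
      rintro w ⟨h1, h2, h3, h4⟩
      refine ⟨h1, h2, ?_, h4⟩
      by_contra hxw
      have := hmin w ⟨⟨h1, h2, lt_trans h3 hv1, h4⟩, not_lt.mp hxw⟩
      exact absurd h3 (not_lt.mpr this)
    refine ⟨v.1, ?_, hvx, hv1⟩
    simp only [Set.Finite.mem_toFinset]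
    rcases lt_or_ge v.2 0 with h | h
    · right
      refine ⟨⟨v, hvΛ, hv0, h, rfl⟩, ?_⟩
      have hsub : lowerPoints Λ (v.1, 0) ⊆ lowerPoints Λ (x, y) :=
        (lowerPoints_mono Λ (w := (v.1, 0)) (w' := (v.1, y)) le_rfl hy).trans hleft
      calc _ ≤ (Prod.fst '' lowerPoints Λ (v.1, 0)).ncard :=
            Set.ncard_le_ncard (hseg v.1) ((lowerPoints_finite Λ _).image _)
        _ ≤ (lowerPoints Λ (v.1, 0)).ncard := Set.ncard_image_le (lowerPoints_finite Λ _)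
        _ ≤ _ := Set.ncard_le_ncard hsub (lowerPoints_finite Λ _)
        _ < j := hN
    · left
      refine ⟨v, ⟨hvΛ, by linarith, h, ?_⟩, rfl⟩
      have hsub : lowerPoints Λ v ⊆ lowerPoints Λ (x, y) :=
        (lowerPoints_mono Λ (w := v) (w' := (v.1, y)) le_rfl hv2).trans hleft
      exact (Set.ncard_le_ncard hsub (lowerPoints_finite Λ _)).trans_lt hN

end Covering

/-! ### The area of the staircase -/

theorem tsum_ite_one_eq_encard {ι : Type*} (P : ι → Prop) [DecidablePred P] :
    (∑' i, if P i then (1 : ENNReal) else 0) = ({i | P i}.encard : ENNReal) := by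
  rw [← ENNReal.tsum_set_one, tsum_subtype {i | P i} (fun _ => (1 : ENNReal))]
  refine tsum_congr fun i => ?_
  by_cases h : P i <;> simp [Set.indicator, h]

theorem encard_subtype_lattice {Λ : Submodule ℤ (ℝ × ℝ)} (P : ℝ × ℝ → Prop) :
    {v : Λ | P v}.encard = {v : ℝ × ℝ | v ∈ Λ ∧ P v}.encard := by
  have : {v : ℝ × ℝ | v ∈ Λ ∧ P v} = Subtype.val '' {v : Λ | P v} := by
    ext v
    simp only [Set.mem_ofPred_eq, Set.mem_image, Subtype.exists, exists_and_right, exists_eq_right,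
      exists_prop]
  rw [this, Subtype.val_injective.encard_image]

section Lattice

variable (Λ : Submodule ℤ (ℝ × ℝ)) [DiscreteTopology Λ]

theorem exists_bounded_fundamentalDomain [IsZLattice ℝ Λ] :
    ∃ F : Set (ℝ × ℝ), IsAddFundamentalDomain Λ F volume ∧ MeasurableSet F ∧
      Bornology.IsBounded F ∧ volume F = ENNReal.ofReal (ZLattice.covolume Λ) := by
  have hF := ZLattice.isAddFundamentalDomain (Module.Free.chooseBasis ℤ Λ)
    (volume : Measure (ℝ × ℝ))
  have hb := ZSpan.fundamentalDomain_isBounded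
    ((Module.Free.chooseBasis ℤ Λ).ofZLatticeBasis ℝ Λ)
  refine ⟨_, hF, ZSpan.fundamentalDomain_measurableSet _, hb, ?_⟩
  rw [ZLattice.covolume_eq_measure_fundamentalDomain Λ volume hF, measureReal_def,
    ENNReal.ofReal_toReal hb.measure_lt_top.ne]

theorem measurableSet_stair [IsZLattice ℝ Λ] (j : ℕ) : MeasurableSet (stair Λ j) := by
  classical
  have hcount : ∀ w : ℝ × ℝ, (∑' v : Λ, if (sumKey 0 < sumKey (v : ℝ × ℝ) ∧
      (v : ℝ × ℝ).1 < w.1 ∧ (v : ℝ × ℝ).2 ≤ w.2) then (1 : ENNReal) else 0) =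
        ((lowerPoints Λ w).ncard : ENNReal) := by
    intro w
    rw [tsum_ite_one_eq_encard, encard_subtype_lattice
      (fun v => sumKey 0 < sumKey v ∧ v.1 < w.1 ∧ v.2 ≤ w.2)]
    have : ((lowerPoints Λ w).ncard : ℕ∞) = (lowerPoints Λ w).encard :=
      (lowerPoints_finite Λ w).cast_ncard_eq
    rw [show {v : ℝ × ℝ | v ∈ Λ ∧ sumKey 0 < sumKey v ∧ v.1 < w.1 ∧ v.2 ≤ w.2} =
      lowerPoints Λ w from rfl, ← this]
    simp
  have hmeas : Measurable fun w : ℝ × ℝ => ((lowerPoints Λ w).ncard : ENNReal) := by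
    simp_rw [← hcount]
    refine Measurable.tsum fun v => ?_
    refine Measurable.ite ?_ measurable_const measurable_const
    by_cases hv : sumKey 0 < sumKey (v : ℝ × ℝ)
    · simp only [hv, true_and]
      exact (measurableSet_lt measurable_const measurable_fst).inter
        (measurableSet_le measurable_const measurable_snd)
    · simp [hv]
  have : stair Λ j = {w | 0 < w.1} ∩ ({w | 0 ≤ w.2} ∩
      {w : ℝ × ℝ | ((lowerPoints Λ w).ncard : ENNReal) < j}) := by
    ext w
    simp [stair]
  rw [this]
  exact (measurableSet_lt measurable_const measurable_fst).inter
    ((measurableSet_le measurable_const measurable_snd).inter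
      (measurableSet_lt hmeas measurable_const))

variable {Λ} in
-- Unfolding over a fundamental domain F turns the area into the integral over F of the number of
-- staircase points in a coset, which is constantly j.
theorem volume_stair [IsZLattice ℝ Λ] {j : ℕ}
    (hcov : IsFoldCovering j (latticeTranslates standardTriangle Λ)) :
    volume (stair Λ j) = ENNReal.ofReal (j * ZLattice.covolume Λ) := by
  classical
  have : VAddInvariantMeasure Λ (ℝ × ℝ) volume :=
    inferInstanceAs (VAddInvariantMeasure Λ.toAddSubgroup (ℝ × ℝ) volume)
  obtain ⟨F, hF, -, -, hvol⟩ := exists_bounded_fundamentalDomain Λ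
  have hS := measurableSet_stair Λ j
  calc volume (stair Λ j) = ∫⁻ x, (stair Λ j).indicator 1 x := (lintegral_indicator_one hS).symm
    _ = ∑' v : Λ, ∫⁻ x in F, (stair Λ j).indicator 1 (v +ᵥ x) := hF.lintegral_eq_tsum'' _
    _ = ∫⁻ x in F, ∑' v : Λ, (stair Λ j).indicator 1 (v +ᵥ x) := by
        rw [lintegral_tsum]
        intro v
        have hm : Measurable ((stair Λ j).indicator (1 : ℝ × ℝ → ENNReal)) :=
          measurable_one.indicator hS
        exact (hm.comp (measurable_const_vadd v)).aemeasurable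
    _ = ∫⁻ x in F, (j : ENNReal) := by
        refine lintegral_congr fun x => ?_
        have h := encard_translate_stair hcov x
        rw [← encard_subtype_lattice (fun v => x + v ∈ stair Λ j)] at h
        calc _ = ∑' v : Λ, (if x + (v : ℝ × ℝ) ∈ stair Λ j then (1 : ENNReal) else 0) := by
              refine tsum_congr fun v => ?_
              have : v +ᵥ x = x + (v : ℝ × ℝ) := add_comm _ _
              rw [this]
              simp [Set.indicator]
          _ = _ := by rw [tsum_ite_one_eq_encard, h]; simp
    _ = _ := by
        rw [setLIntegral_const, hvol, ENNReal.ofReal_mul (by positivity), ENNReal.ofReal_natCast]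

end Lattice

/-! ### Inscribed rectangles and the covolume bound -/

/-- A finite set of reals, cut down to the open unit interval and completed to a subdivision. -/
theorem exists_subdivision (E : Finset ℝ) {N : ℕ} (hE : E.card ≤ N) :
    ∃ e : ℕ → ℝ, Monotone e ∧ e 0 = 0 ∧ e (N + 1) = 1 ∧
      (∀ i, e i = 0 ∨ e i = 1 ∨ e i ∈ E) ∧ ∀ x ∈ E, 0 < x → x < 1 → ∃ i, e i = x := by
  classical
  set E' := E.filter fun x => 0 < x ∧ x < 1 with hE'
  have hr : E'.card ≤ N := (Finset.card_filter_le _ _).trans hE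
  set f := E'.orderEmbOfFin rfl with hf
  have hfmem : ∀ i, f i ∈ E' := fun i => Finset.orderEmbOfFin_mem _ _ _
  have hf0 : ∀ i, 0 < f i := fun i => (Finset.mem_filter.mp (hfmem i)).2.1
  have hf1 : ∀ i, f i < 1 := fun i => (Finset.mem_filter.mp (hfmem i)).2.2
  -- If fewer than N points remain, the sequence is padded with the value 1, giving degenerate
  -- intervals.
  refine ⟨fun i => if i = 0 then 0 else if h : i - 1 < E'.card then f ⟨i - 1, h⟩ else 1,
    ?_, by simp, ?_, ?_, ?_⟩
  · refine monotone_nat_of_le_succ fun i => ?_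
    simp only [Nat.add_eq_zero_iff, one_ne_zero, and_false, if_false, Nat.add_sub_cancel]
    by_cases hi : i = 0
    · simp only [hi, if_true]
      split_ifs with h
      · exact (hf0 _).le
      · exact zero_le_one
    · simp only [hi, if_false]
      by_cases h : i < E'.card
      · have h' : i - 1 < E'.card := by omega
        simp only [h, h', dif_pos]
        exact f.monotone (Fin.mk_le_mk.mpr (Nat.sub_le _ _))
      · simp only [h, dif_neg, not_false_eq_true]
        split_ifs
        · exact (hf1 _).le
        · exact le_rfl
  · have : ¬ N < E'.card := by omega
    simp [this]
  · intro i
    by_cases hi : i = 0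
    · simp [hi]
    · by_cases h : i - 1 < E'.card
      · right; right
        simp only [hi, if_false, h, dif_pos]
        exact (Finset.mem_filter.mp (hfmem _)).1
      · right; left
        simp [hi, h]
  · intro x hx hx0 hx1
    have : x ∈ Set.range f := by
      rw [hf, Finset.range_orderEmbOfFin]
      simp [hE', hx, hx0, hx1]
    obtain ⟨k, hk⟩ := this
    exact ⟨k + 1, by simp [hk]⟩

/-- Completing the square: the deficit from the maximal area is half the sum of squared deviations
of the steps from 1/n, which also settles the equality case. -/
theorem sum_rectangles_eq (e : ℕ → ℝ) {n : ℕ} (hn : 0 < n) (h0 : e 0 = 0) (h1 : e n = 1) :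
    ∑ i ∈ Finset.range n, (e (i + 1) - e i) * (1 - e (i + 1)) =
      1 / 2 - 1 / (2 * n) - 1 / 2 * ∑ i ∈ Finset.range n, (e (i + 1) - e i - 1 / n) ^ 2 := by
  have hn' : (n : ℝ) ≠ 0 := by positivity
  have ha : ∑ i ∈ Finset.range n, (e (i + 1) - e i) = 1 := by
    rw [Finset.sum_range_sub, h0, h1, sub_zero]
  have hb : ∑ i ∈ Finset.range n, (e (i + 1) ^ 2 - e i ^ 2) = 1 := by
    rw [Finset.sum_range_sub (fun i => e i ^ 2), h0, h1]; norm_num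
  have hc : ∀ i, (e (i + 1) - e i) * (1 - e (i + 1)) =
      (1 - 1 / (n : ℝ)) * (e (i + 1) - e i) - 1 / 2 * (e (i + 1) ^ 2 - e i ^ 2) + 1 / (2 * n ^ 2)
        - 1 / 2 * (e (i + 1) - e i - 1 / n) ^ 2 := by
    intro i
    field_simp
    ring
  simp_rw [hc]
  rw [Finset.sum_sub_distrib, Finset.sum_add_distrib, Finset.sum_sub_distrib, ← Finset.mul_sum,
    ← Finset.mul_sum, ← Finset.mul_sum, ha, hb]
  simp only [Finset.sum_const, Finset.card_range, nsmul_eq_mul]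
  field_simp
  ring

theorem volume_rectangles_le (e : ℕ → ℝ) (n : ℕ) (he : Monotone e) (h1 : e n = 1) :
    volume (⋃ i ∈ Finset.range n, Set.Ioc (e i) (e (i + 1)) ×ˢ Set.Icc 0 (1 - e (i + 1))) ≤
      ENNReal.ofReal (∑ i ∈ Finset.range n, (e (i + 1) - e i) * (1 - e (i + 1))) := by
  refine (measure_biUnion_finset_le _ _).trans ?_
  rw [ENNReal.ofReal_sum_of_nonneg]
  · refine Finset.sum_le_sum fun i _ => ?_
    rw [Measure.volume_eq_prod, Measure.prod_prod, Real.volume_Ioc, Real.volume_Icc, sub_zero,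
      ENNReal.ofReal_mul (sub_nonneg.mpr (he (Nat.le_succ i)))]
  · intro i hi
    have hi := Finset.mem_range.mp hi
    have : e (i + 1) ≤ 1 := h1 ▸ he hi
    exact mul_nonneg (sub_nonneg.mpr (he (Nat.le_succ i))) (sub_nonneg.mpr this)

theorem stair_subset_rectangles {Λ : Submodule ℤ (ℝ × ℝ)} [DiscreteTopology Λ] {j : ℕ}
    (hcov : IsFoldCovering j (latticeTranslates standardTriangle Λ)) {E : Finset ℝ}
    (hstep : ∀ x x' y : ℝ, (x, y) ∈ stair Λ j → x < x' → (x', y) ∉ stair Λ j →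
        ∃ e ∈ E, x ≤ e ∧ e < x')
    {e : ℕ → ℝ} {n : ℕ} (he : Monotone e) (h0 : e 0 = 0) (h1 : e n = 1)
    (hmem : ∀ x ∈ E, 0 < x → x < 1 → ∃ i, e i = x) :
    stair Λ j ⊆
      ⋃ i ∈ Finset.range n, Set.Ioc (e i) (e (i + 1)) ×ˢ Set.Icc 0 (1 - e (i + 1)) := by
  classical
  rintro ⟨x, y⟩ hw
  have hx0 : 0 < x := hw.1
  have hy0 : 0 ≤ y := hw.2.1
  have hx1 : x ≤ 1 := by
    have := stair_sum_le_one hcov hw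
    simp only at this
    linarith
  have hex : ∃ k, x ≤ e k := ⟨n, h1 ▸ hx1⟩
  have hk := Nat.find_spec hex
  have hk0 : Nat.find hex ≠ 0 := by
    intro h
    rw [h, h0] at hk
    linarith
  obtain ⟨i, hi⟩ := Nat.exists_eq_succ_of_ne_zero hk0
  have hin : i < n := by
    have : Nat.find hex ≤ n := Nat.find_min' hex (h1 ▸ hx1)
    omega
  have hei : e i < x := not_le.mp (Nat.find_min hex (by omega))
  rw [hi] at hk
  simp only [Set.mem_iUnion, Finset.mem_range, Set.mem_prod, Set.mem_Ioc, Set.mem_Icc]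
  refine ⟨i, hin, ⟨hei, hk⟩, hy0, ?_⟩
  have hei1 : e (i + 1) ≤ 1 := h1 ▸ he hin
  rcases hk.eq_or_lt with heq | hlt
  · have := stair_sum_le_one hcov hw
    simp only at this
    have heq : x = e (i + 1) := heq
    linarith
  -- No descent occurs strictly inside a cell, so the point can be pushed to the right end of the
  -- cell, where the hypotenuse bounds its height.
  · have hin' : (e (i + 1), y) ∈ stair Λ j := by
      by_contra hno
      obtain ⟨z, hz, hxz, hzi⟩ := hstep x (e (i + 1)) y hw hlt hno
      obtain ⟨k, rfl⟩ := hmem z hz (by linarith) (by linarith)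
      have hik : i < k := by
        by_contra hh
        have := he (not_lt.mp hh)
        linarith
      have := he (Nat.succ_le_of_lt hik)
      simp only [Nat.succ_eq_add_one] at this
      linarith
    have := stair_sum_le_one hcov hin'
    simp only at this
    linarith

theorem covolume_le_of_covering {Λ : Submodule ℤ (ℝ × ℝ)} [DiscreteTopology Λ] [IsZLattice ℝ Λ]
    {j : ℕ} (hj : 1 ≤ j) (hcov : IsFoldCovering j (latticeTranslates standardTriangle Λ)) :
    ZLattice.covolume Λ ≤ 1 / (2 * j + 1 : ℕ) := by
  obtain ⟨E, hE, -, -, hstep⟩ := exists_stair_steps hcov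
  obtain ⟨e, he, h0, h1, -, hmem⟩ := exists_subdivision E hE
  have h := measure_mono (μ := volume) (stair_subset_rectangles hcov hstep he h0 h1 hmem)
  have h := h.trans (volume_rectangles_le e (2 * j + 1) he h1)
  have hpos : 0 < j * ZLattice.covolume Λ :=
    mul_pos (by exact_mod_cast hj) (ZLattice.covolume_pos Λ)
  rw [volume_stair hcov] at h
  have h := (ENNReal.ofReal_le_ofReal_iff').mp h
  have h := h.resolve_right (not_le.mpr hpos)
  rw [sum_rectangles_eq e (by omega) h0 h1] at h
  have hs : 0 ≤ ∑ i ∈ Finset.range (2 * j + 1), (e (i + 1) - e i - 1 / (2 * j + 1 : ℕ)) ^ 2 :=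
    Finset.sum_nonneg fun i _ => sq_nonneg _
  have hj' : (0 : ℝ) < j := by exact_mod_cast hj
  have h2 : j * ZLattice.covolume Λ ≤ j * (1 / (2 * j + 1 : ℕ)) := by
    have : (j : ℝ) * (1 / (2 * j + 1 : ℕ)) = 1 / 2 - 1 / (2 * (2 * j + 1 : ℕ)) := by
      push_cast
      field_simp
      ring
    linarith
  exact le_of_mul_le_mul_left h2 hj'

/-! ### From equality of areas to equality of sets -/

/-- With `<` in the first coordinate and `≤` in the second, the finite set of lower points does not
change under small moves to the left and upwards. -/
theorem exists_lowerPoints_eq (Λ : Submodule ℤ (ℝ × ℝ)) [DiscreteTopology Λ] (w : ℝ × ℝ) :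
    ∃ δ > 0, ∀ x y, w.1 - δ < x → x ≤ w.1 → w.2 ≤ y → y < w.2 + δ →
      lowerPoints Λ (x, y) = lowerPoints Λ w := by
  have hfin := lowerPoints_finite Λ (w.1, w.2 + 1)
  have hev : ∀ᶠ δ : ℝ in nhdsWithin 0 (Set.Ioi 0), ∀ v ∈ lowerPoints Λ (w.1, w.2 + 1),
      v.1 < w.1 - δ ∧ (v.2 ≤ w.2 ∨ w.2 + δ < v.2) := by
    rw [eventually_all_finite hfin]
    rintro v ⟨-, -, h, -⟩
    simp only at h
    refine Filter.Eventually.and ?_ ?_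
    · filter_upwards [nhdsWithin_le_nhds (Iio_mem_nhds (sub_pos.mpr h))] with δ hδ
      simp only [Set.mem_Iio] at hδ
      linarith
    · rcases le_or_gt v.2 w.2 with h' | h'
      · exact Eventually.of_forall fun _ => Or.inl h'
      · filter_upwards [nhdsWithin_le_nhds (Iio_mem_nhds (sub_pos.mpr h'))] with δ hδ
        simp only [Set.mem_Iio] at hδ
        right
        linarith
  obtain ⟨δ, hδ, hδ0, hδ1⟩ :=
    (hev.and (Ioo_mem_nhdsGT (zero_lt_one (α := ℝ)))).exists
  refine ⟨δ, hδ0, fun x y hx hx' hy hy' => Set.Subset.antisymm ?_ ?_⟩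
  · rintro v ⟨h1, h2, h3, h4⟩
    simp only at h3 h4
    refine ⟨h1, h2, by linarith, ?_⟩
    rcases (hδ v ⟨h1, h2, by simp only; linarith, by simp only; linarith⟩).2 with h | h
    · exact h
    · linarith
  · rintro v ⟨h1, h2, h3, h4⟩
    refine ⟨h1, h2, ?_, by simp only; linarith⟩
    have := (hδ v ⟨h1, h2, h3, by simp only; linarith⟩).1
    simp only
    linarith

/-- The staircase with steps of equal length `1 / n` inscribed in the standard triangle. -/
def regularStair (n : ℕ) : Set (ℝ × ℝ) :=
  {w | 0 < w.1 ∧ 0 ≤ w.2 ∧ ⌈n * w.1⌉ + ⌊n * w.2⌋ ≤ (n : ℤ) - 1}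

theorem stair_subset_regularStair {Λ : Submodule ℤ (ℝ × ℝ)} [DiscreteTopology Λ] {j n : ℕ}
    (hn : 0 < n)
    (h : stair Λ j ⊆ ⋃ i ∈ Finset.range n, Set.Ioc ((i : ℝ) / n) ((i + 1 : ℕ) / n) ×ˢ
      Set.Icc 0 (1 - ((i + 1 : ℕ) : ℝ) / n)) : stair Λ j ⊆ regularStair n := by
  intro w hw
  have hn' : (0 : ℝ) < n := by exact_mod_cast hn
  obtain ⟨δ, hδ, heq⟩ := exists_lowerPoints_eq Λ w
  -- A slightly higher point is still in the staircase, so w stays strictly below the top edge of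
  -- its rectangle.
  have hw' : (w.1, w.2 + δ / 2) ∈ stair Λ j := by
    refine ⟨hw.1, by have := hw.2.1; simp only; linarith, ?_⟩
    rw [heq _ _ (by linarith) le_rfl (by linarith) (by linarith)]
    exact hw.2.2
  have hmem := h hw'
  simp only [Set.mem_iUnion, Finset.mem_range, Set.mem_prod, Set.mem_Ioc, Set.mem_Icc] at hmem
  obtain ⟨i, -, ⟨-, h1⟩, -, h2⟩ := hmem
  refine ⟨hw.1, hw.2.1, ?_⟩
  have h3 : ⌈n * w.1⌉ ≤ (i : ℤ) + 1 := by
    rw [Int.ceil_le]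
    rw [le_div_iff₀ hn'] at h1
    push_cast at h1 ⊢
    linarith
  have h4 : ⌊n * w.2⌋ < (n : ℤ) - (i + 1) := by
    rw [Int.floor_lt]
    have : w.2 < 1 - ((i + 1 : ℕ) : ℝ) / n := by linarith
    have := mul_lt_mul_of_pos_left this hn'
    rw [mul_sub, mul_one, mul_div_cancel₀ _ hn'.ne'] at this
    push_cast at this ⊢
    linarith
  omega

/-- A missing point would bring with it a small open box to its upper left, of positive area,
contradicting equality of areas. -/
theorem regularStair_subset_stair {Λ : Submodule ℤ (ℝ × ℝ)} [DiscreteTopology Λ] [IsZLattice ℝ Λ]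
    {j n : ℕ} (hn : 0 < n)
    (hsub : stair Λ j ⊆ ⋃ i ∈ Finset.range n, Set.Ioc ((i : ℝ) / n) ((i + 1 : ℕ) / n) ×ˢ
      Set.Icc 0 (1 - ((i + 1 : ℕ) : ℝ) / n))
    (hvol : volume (⋃ i ∈ Finset.range n, Set.Ioc ((i : ℝ) / n) ((i + 1 : ℕ) / n) ×ˢ
      Set.Icc 0 (1 - ((i + 1 : ℕ) : ℝ) / n)) ≤ volume (stair Λ j))
    (hfin : volume (stair Λ j) ≠ ⊤) : regularStair n ⊆ stair Λ j := by
  intro w hw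
  by_contra hnot
  have hn' : (0 : ℝ) < n := by exact_mod_cast hn
  obtain ⟨hw1, hw2, hw3⟩ := hw
  have hcard : j ≤ (lowerPoints Λ w).ncard := by
    by_contra hlt
    exact hnot ⟨hw1, hw2, not_le.mp hlt⟩
  obtain ⟨δ, hδ, heq⟩ := exists_lowerPoints_eq Λ w
  have hceil : 0 < ⌈n * w.1⌉ := Int.ceil_pos.mpr (by positivity)
  obtain ⟨i, hi⟩ : ∃ i : ℕ, ⌈n * w.1⌉ = (i : ℤ) + 1 := ⟨(⌈n * w.1⌉ - 1).toNat, by omega⟩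
  have hfl : 0 ≤ ⌊n * w.2⌋ := Int.floor_nonneg.mpr (by positivity)
  have hin : i < n := by omega
  have hx1 : (i : ℝ) / n < w.1 := by
    have := (Int.ceil_eq_iff.mp hi).1
    push_cast at this
    rw [div_lt_iff₀ hn']
    linarith
  have hx2 : w.1 ≤ ((i + 1 : ℕ) : ℝ) / n := by
    have := (Int.ceil_eq_iff.mp hi).2
    push_cast at this
    rw [le_div_iff₀ hn']
    push_cast
    linarith
  have hy : w.2 < 1 - ((i + 1 : ℕ) : ℝ) / n := by
    have h4 : ⌊n * w.2⌋ < (n : ℤ) - (i + 1) := by omega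
    rw [Int.floor_lt] at h4
    push_cast at h4
    rw [lt_sub_iff_add_lt, ← lt_sub_iff_add_lt', div_lt_iff₀ hn']
    push_cast
    linarith
  set B : Set (ℝ × ℝ) := Set.Ioo (max (w.1 - δ) ((i : ℝ) / n)) w.1 ×ˢ
    Set.Ioo w.2 (min (w.2 + δ) (1 - ((i + 1 : ℕ) : ℝ) / n)) with hB
  have hBsub : B ⊆ (⋃ i ∈ Finset.range n, Set.Ioc ((i : ℝ) / n) ((i + 1 : ℕ) / n) ×ˢ
      Set.Icc 0 (1 - ((i + 1 : ℕ) : ℝ) / n)) \ stair Λ j := by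
    rintro ⟨x, y⟩ ⟨⟨hx, hx'⟩, hy1, hy2⟩
    simp only at hx hx' hy1 hy2
    have hxa := (max_lt_iff.mp hx)
    have hya := (lt_min_iff.mp hy2)
    constructor
    · simp only [Set.mem_iUnion, Finset.mem_range, Set.mem_prod, Set.mem_Ioc, Set.mem_Icc]
      exact ⟨i, hin, ⟨hxa.2, by linarith⟩, by linarith, hya.2.le⟩
    · rintro ⟨-, -, h⟩
      rw [heq x y hxa.1 hx'.le hy1.le hya.1] at h
      omega
  have hzero : volume B = 0 := by
    refine measure_mono_null hBsub ?_
    rw [measure_sdiff hsub (measurableSet_stair Λ j).nullMeasurableSet hfin]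
    exact tsub_eq_zero_of_le hvol
  have hpos : 0 < volume B := by
    refine (isOpen_Ioo.prod isOpen_Ioo).measure_pos _ (Set.Nonempty.prod ?_ ?_)
    · exact Set.nonempty_Ioo.mpr (max_lt (by linarith) hx1)
    · exact Set.nonempty_Ioo.mpr (lt_min (by linarith) hy)
  exact hpos.ne' hzero

/-! ### Rigidity of extremal lattices -/

section Extremal

variable {Λ : Submodule ℤ (ℝ × ℝ)} [DiscreteTopology Λ] [IsZLattice ℝ Λ] {j : ℕ}

theorem extremal_structure (hj : 1 ≤ j)
    (hcov : IsFoldCovering j (latticeTranslates standardTriangle Λ))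
    (hD : ZLattice.covolume Λ = 1 / (2 * j + 1 : ℕ)) :
    stair Λ j = regularStair (2 * j + 1) ∧
      (∀ v ∈ Λ, v ∈ stair Λ j → ∃ k : ℤ, (2 * j + 1 : ℕ) * v.1 = k) ∧
      ∃ v ∈ Λ, v.1 = 1 / (2 * j + 1 : ℕ) := by
  obtain ⟨E, hE, hES, hEΛ, hstep⟩ := exists_stair_steps hcov
  obtain ⟨e, he, h0, h1, hemem, hmem⟩ := exists_subdivision E hE
  have hsub := stair_subset_rectangles hcov hstep he h0 h1 hmem
  have hrect := volume_rectangles_le e (2 * j + 1) he h1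
  have hvol := volume_stair hcov
  have hsum := sum_rectangles_eq e (n := 2 * j + 1) (by omega) h0 h1
  have hj' : (0 : ℝ) < j := by exact_mod_cast hj
  set n : ℕ := 2 * j + 1 with hn
  have hn0 : (0 : ℝ) < n := by rw [hn]; positivity
  have harea : (j : ℝ) * (1 / n) = 1 / 2 - 1 / (2 * n) := by
    rw [hn]
    push_cast
    field_simp
    ring
  rw [hD] at hvol
  have hle := (hvol ▸ measure_mono (μ := volume) hsub).trans hrect
  have hle := ((ENNReal.ofReal_le_ofReal_iff').mp hle).resolve_right (not_le.mpr (by positivity))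
  have hs0 : ∀ i ∈ Finset.range n, (0 : ℝ) ≤ (e (i + 1) - e i - 1 / n) ^ 2 :=
    fun i _ => sq_nonneg _
  have hzero : ∑ i ∈ Finset.range n, (e (i + 1) - e i - 1 / n) ^ 2 = 0 :=
    le_antisymm (by linarith) (Finset.sum_nonneg hs0)
  have hd := (Finset.sum_eq_zero_iff_of_nonneg hs0).mp hzero
  have hei : ∀ i ≤ n, e i = (i : ℝ) / n := by
    intro i
    induction i with
    | zero => simp [h0]
    | succ i ih =>
      intro hi
      have h := pow_eq_zero_iff (two_ne_zero) |>.mp (hd i (Finset.mem_range.mpr hi))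
      rw [ih (by omega)] at h
      push_cast
      rw [add_div]
      linarith
  have heE : ∀ i, 0 < i → i < n → (i : ℝ) / n ∈ E := by
    intro i hi hin
    have hi' : (0 : ℝ) < i := by exact_mod_cast hi
    have hin' : (i : ℝ) < n := by exact_mod_cast hin
    rcases hemem i with h | h | h <;> rw [hei i hin.le] at h
    · exact absurd h (by positivity)
    · rw [div_eq_one_iff_eq hn0.ne'] at h
      linarith
    · exact h
  -- The 2j interior nodes are distinct members of E, which has at most 2j elements, so they exhaust
  -- it.
  have himg : (Finset.range (2 * j)).image (fun i : ℕ => ((i + 1 : ℕ) : ℝ) / n) = E := by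
    apply Finset.eq_of_subset_of_card_le
    · intro x hx
      obtain ⟨i, hi, rfl⟩ := Finset.mem_image.mp hx
      have := Finset.mem_range.mp hi
      exact heE (i + 1) (by omega) (by omega)
    · rw [Finset.card_image_of_injective, Finset.card_range]
      · exact hE
      · intro a b hab
        have hab : ((a + 1 : ℕ) : ℝ) / n = ((b + 1 : ℕ) : ℝ) / n := hab
        rw [div_left_inj' hn0.ne'] at hab
        have : a + 1 = b + 1 := by exact_mod_cast hab
        omega
  have hunion : (⋃ i ∈ Finset.range n, Set.Ioc (e i) (e (i + 1)) ×ˢ Set.Icc 0 (1 - e (i + 1))) =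
      ⋃ i ∈ Finset.range n, Set.Ioc ((i : ℝ) / n) ((i + 1 : ℕ) / n) ×ˢ
        Set.Icc 0 (1 - ((i + 1 : ℕ) : ℝ) / n) := by
    refine Set.iUnion₂_congr fun i hi => ?_
    have := Finset.mem_range.mp hi
    rw [hei i (by omega), hei (i + 1) (by omega)]
  rw [hsum, hzero, mul_zero, sub_zero, ← harea, ← hvol, hunion] at hrect
  rw [hunion] at hsub
  refine ⟨Set.Subset.antisymm (stair_subset_regularStair (by omega) hsub)
    (regularStair_subset_stair (by omega) hsub hrect (by rw [hvol]; exact ENNReal.ofReal_ne_top)),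
    ?_, ?_⟩
  · intro v hv hvs
    have := hES v hv hvs
    rw [← himg] at this
    obtain ⟨i, -, hi⟩ := Finset.mem_image.mp this
    refine ⟨(i + 1 : ℕ), ?_⟩
    rw [← hi]
    push_cast
    field_simp
  · have := hEΛ _ (heE 1 one_pos (by omega))
    simpa using this

/-- Slide the regular staircase to the right. Every translate contains exactly j lattice points, and
integral ones leave only at multiples of 1/n, so no nonintegral one can enter. -/
theorem strip_integral (hj : 1 ≤ j)
    (hcov : IsFoldCovering j (latticeTranslates standardTriangle Λ))
    (hD : ZLattice.covolume Λ = 1 / (2 * j + 1 : ℕ)) {p : ℝ × ℝ} (hp : p ∈ Λ) (hp1 : 0 < p.1)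
    (hp2 : 0 ≤ p.2) (hp3 : (2 * j + 1 : ℕ) * p.2 < (2 * j + 1 : ℕ) - 1) :
    ∃ k : ℤ, (2 * j + 1 : ℕ) * p.1 = k := by
  obtain ⟨hS, hcol, -⟩ := extremal_structure hj hcov hD
  set n : ℕ := 2 * j + 1 with hn
  have hn0 : (0 : ℝ) < n := by rw [hn]; positivity
  have hcount : ∀ x : ℝ, {v : ℝ × ℝ | v ∈ Λ ∧ v - (x, 0) ∈ regularStair n}.encard = j := by
    intro x
    rw [← encard_translate_stair hcov (-(x, 0)), hS]
    congr 1
    ext v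
    simp [sub_eq_neg_add]
  -- For x in [i/n, (i+1)/n) the integral points present at i/n are still present; there are already
  -- j of them, so there are no others.
  have hspread : ∀ i : ℕ,
      (∀ v ∈ Λ, v - ((i : ℝ) / n, 0) ∈ regularStair n → ∃ k : ℤ, n * v.1 = k) →
      ∀ x : ℝ, ⌊n * x⌋ = i → ∀ v ∈ Λ, v - (x, 0) ∈ regularStair n → ∃ k : ℤ, n * v.1 = k := by
    intro i hi x hx v hv hvx
    have hsub : {v : ℝ × ℝ | v ∈ Λ ∧ v - ((i : ℝ) / n, 0) ∈ regularStair n} ⊆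
        {v : ℝ × ℝ | v ∈ Λ ∧ v - (x, 0) ∈ regularStair n} := by
      rintro u ⟨hu, hui⟩
      obtain ⟨k, hk⟩ := hi u hu hui
      obtain ⟨h1, h2, h3⟩ := hui
      simp only [Prod.fst_sub, Prod.snd_sub, sub_zero] at h1 h2 h3
      have hc : ∀ z : ℝ, ⌊n * z⌋ = i → ⌈n * (u.1 - z)⌉ = k - i := by
        intro z hz
        rw [mul_sub, hk, sub_eq_add_neg, Int.ceil_intCast_add, Int.ceil_neg, hz]
        ring
      rw [hc ((i : ℝ) / n) (by rw [mul_div_cancel₀ _ hn0.ne']; simp)] at h3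
      refine ⟨hu, ?_, by simpa using h2, ?_⟩
      · have hki : (i : ℤ) < k := by
          have : (i : ℝ) < n * u.1 := by
            rw [sub_pos, div_lt_iff₀ hn0] at h1
            linarith
          rw [hk] at this
          exact_mod_cast this
        have : n * x < k := by
          have h := Int.lt_floor_add_one (n * x)
          rw [hx] at h
          have : ((i : ℤ) : ℝ) + 1 ≤ k := by exact_mod_cast hki
          linarith
        rw [← hk] at this
        have := lt_of_mul_lt_mul_left this hn0.le
        simpa using this
      · simp only [Prod.fst_sub, Prod.snd_sub, sub_zero]
        rwa [hc x hx]
    have hfin : {v : ℝ × ℝ | v ∈ Λ ∧ v - (x, 0) ∈ regularStair n}.Finite :=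
      Set.finite_of_encard_eq_coe (hcount x)
    have heq := (hfin.subset hsub).eq_of_subset_of_encard_le hsub (by rw [hcount, hcount])
    have : v ∈ {v : ℝ × ℝ | v ∈ Λ ∧ v - ((i : ℝ) / n, 0) ∈ regularStair n} := heq ▸ ⟨hv, hvx⟩
    exact hi v hv this.2
  have hall : ∀ i : ℕ, ∀ v ∈ Λ, v - ((i : ℝ) / n, 0) ∈ regularStair n →
      ∃ k : ℤ, n * v.1 = k := by
    intro i
    induction i with
    | zero =>
      intro v hv hvs
      refine hcol v hv ?_
      rw [hS]
      simpa [← Prod.zero_eq_mk] using hvs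
    | succ i ih =>
      intro v hv hvs
      by_contra hno
      obtain ⟨h1, h2, h3⟩ := hvs
      simp only [Prod.fst_sub, Prod.snd_sub, sub_zero] at h1 h2 h3
      set q : ℝ := v.1 - ((i + 1 : ℕ) : ℝ) / n with hq
      have hnq : n * v.1 = n * q + (i + 1 : ℕ) := by
        rw [hq, mul_sub, mul_div_cancel₀ _ hn0.ne']
        ring
      have hlt : n * q < ⌈n * q⌉ := by
        refine lt_of_le_of_ne (Int.le_ceil _) fun h => hno ⟨⌈n * q⌉ + (i + 1 : ℕ), ?_⟩
        rw [hnq]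
        push_cast
        rw [← h]
      -- A nonintegral point survives a shift of the staircase left by t/n, with t below both 1 and
      -- its distance to the next ceiling; this lands in the preceding interval.
      obtain ⟨t, ht0, ht⟩ : ∃ t > 0, t < min 1 (⌈n * q⌉ - n * q) :=
        exists_between (lt_min one_pos (sub_pos.mpr hlt))
      obtain ⟨ht1, ht2⟩ := lt_min_iff.mp ht
      have hfl : ⌊n * (((i + 1 : ℕ) : ℝ) / n - t / n)⌋ = (i : ℤ) := by
        rw [mul_sub, mul_div_cancel₀ _ hn0.ne', mul_div_cancel₀ _ hn0.ne', Int.floor_eq_iff]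
        push_cast
        constructor <;> linarith
      refine hno (hspread i ih _ hfl v hv ⟨?_, by simpa using h2, ?_⟩)
      · simp only [Prod.fst_sub]
        have : 0 < t / n := by positivity
        linarith
      · simp only [Prod.fst_sub, Prod.snd_sub, sub_zero]
        have hce : ⌈n * (v.1 - (((i + 1 : ℕ) : ℝ) / n - t / n))⌉ = ⌈n * q⌉ := by
          have : n * (v.1 - (((i + 1 : ℕ) : ℝ) / n - t / n)) = n * q + t := by
            rw [hq]
            field_simp
            ring
          rw [this, Int.ceil_eq_iff]
          have := (Int.ceil_eq_iff.mp (rfl : ⌈n * q⌉ = ⌈n * q⌉)).1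
          constructor <;> linarith
        rwa [hce]
  -- This offset puts p in the first, tallest column of the translated staircase while keeping x
  -- nonnegative.
  set x : ℝ := max 0 (p.1 - 1 / n) with hx
  have hx0 : 0 ≤ n * x := mul_nonneg hn0.le (le_max_left _ _)
  refine hspread ⌊n * x⌋₊ (hall _) x (Int.natCast_floor_eq_floor hx0).symm p hp ⟨?_, by simpa, ?_⟩
  · simp only [Prod.fst_sub, sub_pos, hx]
    have : 0 < 1 / (n : ℝ) := by positivity
    exact max_lt hp1 (by linarith)
  · simp only [Prod.fst_sub, Prod.snd_sub, sub_zero]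
    have h1 : ⌈n * (p.1 - x)⌉ ≤ 1 := by
      rw [Int.ceil_le]
      have : p.1 - x ≤ 1 / n := by
        have := le_max_right 0 (p.1 - 1 / (n : ℝ))
        linarith
      have := mul_le_mul_of_nonneg_left this hn0.le
      rw [mul_one_div_cancel hn0.ne'] at this
      exact_mod_cast this
    have h2 : ⌊n * p.2⌋ < (n : ℤ) - 1 := by
      rw [Int.floor_lt]
      exact_mod_cast hp3
    omega

/-- Subtracting multiples of a lattice vector a of small positive height brings any p into the strip
of `strip_integral`; if the remainder q has abscissa ≤ 0, then a - q is used instead. -/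
theorem fst_integral_of_extremal (hj : 1 ≤ j)
    (hcov : IsFoldCovering j (latticeTranslates standardTriangle Λ))
    (hD : ZLattice.covolume Λ = 1 / (2 * j + 1 : ℕ))
    (hw : ∃ w ∈ Λ, w.2 = 1 / (2 * j + 1 : ℕ)) {p : ℝ × ℝ} (hp : p ∈ Λ) :
    ∃ k : ℤ, (2 * j + 1 : ℕ) * p.1 = k := by
  have hstrip := fun {p} => strip_integral (p := p) hj hcov hD
  obtain ⟨hS, -, -⟩ := extremal_structure hj hcov hD
  have hne := encard_translate_stair hcov 0
  simp only [zero_add, hS] at hne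
  set n : ℕ := 2 * j + 1 with hn
  have hn3 : (3 : ℝ) ≤ n := by
    have : 3 ≤ n := by omega
    exact_mod_cast this
  have hn0 : (0 : ℝ) < n := by linarith
  obtain ⟨a, ha, ha1, ha2, ha3⟩ : ∃ a ∈ Λ, 0 < a.1 ∧ 0 < a.2 ∧ n * a.2 < (n : ℝ) - 1 := by
    have hne' : {v : ℝ × ℝ | v ∈ Λ ∧ v ∈ regularStair n}.Nonempty := by
      rw [← Set.encard_pos, hne]
      exact_mod_cast hj
    obtain ⟨b, hb, hb1, hb2, hb3⟩ := hne'
    rcases hb2.eq_or_lt with h | h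
    · obtain ⟨w, hwΛ, hw2⟩ := hw
      -- If b is horizontal, w has height 1/n, less than (n - 1)/n because n ≥ 3; adding multiples
      -- of b makes its abscissa positive.
      obtain ⟨k, hk⟩ := exists_nat_gt (-w.1 / b.1)
      rw [div_lt_iff₀ hb1] at hk
      refine ⟨w + k • b, Λ.add_mem hwΛ (Λ.smul_of_tower_mem k hb), ?_, ?_, ?_⟩
      · simp; linarith
      · simp [← h, hw2]; positivity
      · simp [← h, hw2, hn0.ne']; linarith
    · refine ⟨b, hb, hb1, h, ?_⟩
      have : 0 < ⌈n * b.1⌉ := Int.ceil_pos.mpr (by positivity)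
      have : ⌊n * b.2⌋ < (n : ℤ) - 1 := by omega
      rw [Int.floor_lt] at this
      exact_mod_cast this
  obtain ⟨ka, hka⟩ := hstrip ha ha1 ha2.le ha3
  set k := ⌊p.2 / a.2⌋ with hk
  have hk1 : k * a.2 ≤ p.2 := (le_div_iff₀ ha2).mp (Int.floor_le _)
  have hk2 : p.2 < (k + 1) * a.2 := (div_lt_iff₀ ha2).mp (Int.lt_floor_add_one _)
  have hq : p - k • a ∈ Λ := Λ.sub_mem hp (Λ.smul_mem k ha)
  have hq2 : (p - k • a).2 = p.2 - k * a.2 := by simp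
  have hq1 : (p - k • a).1 = p.1 - k * a.1 := by simp
  rcases le_or_gt (p - k • a).1 0 with h | h
  · have hq' : a - (p - k • a) ∈ Λ := Λ.sub_mem ha hq
    obtain ⟨l, hl⟩ := hstrip hq' (by simp only [Prod.fst_sub] at h ⊢; linarith)
      (by rw [Prod.snd_sub, hq2]; linarith)
      (lt_of_le_of_lt (mul_le_mul_of_nonneg_left
        (by rw [Prod.snd_sub, hq2]; linarith : (a - (p - k • a)).2 ≤ a.2) hn0.le) ha3)
    refine ⟨ka + k * ka - l, ?_⟩
    rw [Prod.fst_sub, hq1] at hl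
    push_cast
    rw [← hl, ← hka]
    ring
  · obtain ⟨l, hl⟩ := hstrip hq h (by rw [hq2]; linarith)
      (lt_of_le_of_lt (mul_le_mul_of_nonneg_left
        (by rw [hq2]; linarith : (p - k • a).2 ≤ a.2) hn0.le) ha3)
    refine ⟨l + k * ka, ?_⟩
    rw [hq1] at hl
    push_cast
    rw [← hl, ← hka]
    ring

end Extremal

/-! ### The residue count and the converse -/

theorem injOn_affine_mod {m n : ℕ} (h : Nat.gcd m n = 1) (r : ℕ) :
    Set.InjOn (fun a => (m * a + r) % n) (Finset.range n) := by
  intro a ha b hb hab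
  have ha : a < n := by simpa using ha
  have hb : b < n := by simpa using hb
  have hab : m * a + r ≡ m * b + r [MOD n] := hab
  have h1 := Nat.ModEq.add_right_cancel' r hab
  have h2 := Nat.ModEq.cancel_left_of_coprime (by rwa [Nat.gcd_comm]) h1
  exact Nat.ModEq.eq_of_lt_of_lt h2 ha hb

theorem sum_affine_mod {m n : ℕ} (hn : 0 < n) (h : Nat.gcd m n = 1) (r : ℕ) :
    ∑ a ∈ Finset.range n, (m * a + r) % n = ∑ a ∈ Finset.range n, a := by
  have himg : (Finset.range n).image (fun a => (m * a + r) % n) = Finset.range n := by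
    apply Finset.eq_of_subset_of_card_le
    · intro x hx
      obtain ⟨a, -, rfl⟩ := Finset.mem_image.mp hx
      exact Finset.mem_range.mpr (Nat.mod_lt _ hn)
    · rw [Finset.card_image_of_injOn (injOn_affine_mod h r)]
  conv_rhs => rw [← himg]
  rw [Finset.sum_image (injOn_affine_mod h r)]

/-- A residue class modulo `2j + 1` occurs at least `j` times in the discrete triangle. -/
theorem le_card_triangle_residue {m j : ℕ} (h1 : Nat.gcd m (2 * j + 1) = 1)
    (h2 : Nat.gcd (m + 1) (2 * j + 1) = 1) (r : ℕ) :
    j ≤ ((Finset.range (2 * j + 1)).filter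
      fun a => a + (m * a + r) % (2 * j + 1) < 2 * j).card := by
  set n := 2 * j + 1 with hn
  set b : ℕ → ℕ := fun a => (m * a + r) % n with hb
  have hbn : ∀ a, b a < n := fun a => Nat.mod_lt _ (by omega)
  have hc : ∀ a, (a + b a) % n = ((m + 1) * a + r) % n := by
    intro a
    simp only [hb, Nat.add_mod_mod]
    congr 1
    ring
  -- The residues a, b(a) and a + b(a) mod n each run over all of 0, …, n - 1. Comparing sums, a
  -- carry a + b(a) ≥ n occurs exactly (n - 1)/2 = j times; at most one a gives the sum 2j, leaving
  -- at least j.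
  have hdecomp : ∀ a ∈ Finset.range n,
      a + b a = ((m + 1) * a + r) % n + n * (if n ≤ a + b a then 1 else 0) := by
    intro a ha
    have ha := Finset.mem_range.mp ha
    have := hbn a
    rw [← hc]
    split_ifs with h
    · rw [Nat.mod_eq_sub_mod h, Nat.mod_eq_of_lt (by omega)]
      omega
    · rw [Nat.mod_eq_of_lt (by omega)]
      omega
  have hsum := Finset.sum_congr rfl hdecomp
  rw [Finset.sum_add_distrib, Finset.sum_add_distrib, sum_affine_mod (by omega) h2,
    sum_affine_mod (by omega) h1, ← Finset.mul_sum, ← Finset.card_filter] at hsum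
  have hsum := Nat.add_left_cancel hsum
  have hgauss := Finset.sum_range_id_mul_two n
  have hbig : ((Finset.range n).filter fun a => n ≤ a + b a).card = j := by
    rw [hsum, mul_assoc] at hgauss
    have := Nat.eq_of_mul_eq_mul_left (by omega) hgauss
    omega
  have hdiag : ((Finset.range n).filter fun a => a + b a = 2 * j).card ≤ 1 := by
    rw [Finset.card_le_one]
    intro x hx y hy
    have hx := Finset.mem_filter.mp hx
    have hy := Finset.mem_filter.mp hy
    apply injOn_affine_mod h2 r (by simpa using hx.1) (by simpa using hy.1)
    simp only
    rw [← hc, ← hc, hx.2, hy.2]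
  have hcover : Finset.range n ⊆ ((Finset.range n).filter fun a => a + b a < 2 * j) ∪
      (((Finset.range n).filter fun a => a + b a = 2 * j) ∪
        ((Finset.range n).filter fun a => n ≤ a + b a)) := by
    intro a ha
    simp only [Finset.mem_union, Finset.mem_filter, ha, true_and]
    omega
  have hcard := Finset.card_le_card hcover
  rw [Finset.card_range] at hcard
  have h3 := Finset.card_union_le ((Finset.range n).filter fun a => a + b a < 2 * j)
    (((Finset.range n).filter fun a => a + b a = 2 * j) ∪
        ((Finset.range n).filter fun a => n ≤ a + b a))
  have h4 := Finset.card_union_le ((Finset.range n).filter fun a => a + b a = 2 * j)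
    ((Finset.range n).filter fun a => n ≤ a + b a)
  show j ≤ ((Finset.range n).filter fun a => a + b a < 2 * j).card
  omega

/-- Rounding u down to the grid (1/n)ℤ² reduces the count to lattice points (p - k, q - l)/n with k,
l ≥ 0. As u exceeds (p, q)/n by less than 1/n in each coordinate, k + l ≤ n - 2 = 2j - 1 suffices.
-/
theorem isFoldCovering_of_coprime {m j : ℕ} (h1 : Nat.gcd m (2 * j + 1) = 1)
    (h2 : Nat.gcd (m + 1) (2 * j + 1) = 1) {Λ : Submodule ℤ (ℝ × ℝ)}
    (hΛ : ∀ v : ℝ × ℝ, v ∈ Λ ↔ ∃ a b : ℤ,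
      v = ((a : ℝ) / (2 * j + 1 : ℕ), a * ((m : ℝ) / (2 * j + 1 : ℕ)) + b)) :
    IsFoldCovering j (latticeTranslates standardTriangle Λ) := by
  rw [isFoldCovering_standardTriangle_iff]
  intro u
  set n := 2 * j + 1 with hn
  have hn0 : (0 : ℝ) < n := by rw [hn]; positivity
  set p := ⌊n * u.1⌋ with hp
  set q := ⌊n * u.2⌋ with hq
  set r := ((q - m * p) % (n : ℤ)).toNat with hr
  have hr' : (r : ℤ) = (q - m * p) % (n : ℤ) :=
    Int.toNat_of_nonneg (Int.emod_nonneg _ (by omega))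
  set G := (Finset.range n).filter fun a => a + (m * a + r) % n < 2 * j with hG
  have hGcard : j ≤ G.card := le_card_triangle_residue h1 h2 r
  set f : ℕ → ℝ × ℝ := fun k =>
    (((p - k : ℤ) : ℝ) / n, ((q - ((m * k + r) % n : ℕ) : ℤ) : ℝ) / n) with hf
  have hfinj : Function.Injective f := by
    intro a b hab
    have h := congrArg Prod.fst hab
    simp only [hf] at h
    rw [div_left_inj' hn0.ne'] at h
    have h : (p - a : ℤ) = p - b := by exact_mod_cast h
    omega
  calc (j : ℕ∞) ≤ G.card := by exact_mod_cast hGcard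
    _ = (f '' (G : Set ℕ)).encard := by
        rw [hfinj.encard_image, Set.encard_coe_eq_coe_finsetCard]
    _ ≤ _ := Set.encard_le_encard ?_
  rintro _ ⟨k, hk, rfl⟩
  have hk := Finset.mem_filter.mp (Finset.mem_coe.mp hk)
  obtain ⟨l, hl⟩ : ∃ l, l = (m * k + r) % n := ⟨_, rfl⟩
  have hkl' : k + l < 2 * j := hl ▸ hk.2
  have hfk : f k = (((p - k : ℤ) : ℝ) / n, ((q - l : ℤ) : ℝ) / n) := by rw [hl]
  rw [hfk]
  have hp1 : (p : ℝ) ≤ n * u.1 := Int.floor_le _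
  have hp2 : n * u.1 < p + 1 := Int.lt_floor_add_one _
  have hq1 : (q : ℝ) ≤ n * u.2 := Int.floor_le _
  have hq2 : n * u.2 < q + 1 := Int.lt_floor_add_one _
  refine ⟨(hΛ _).mpr ?_, ?_, ?_, ?_⟩
  · have hdvd : (n : ℤ) ∣ (q - l) - m * (p - k) := by
      have e1 : (n : ℤ) ∣ (m * k + r) - l := by
        have : (l : ℤ) = (m * k + r) % (n : ℤ) := by rw [hl]; push_cast; rfl
        rw [this]
        exact Int.dvd_self_sub_emod
      have e2 : (n : ℤ) ∣ (q - m * p) - r := by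
        rw [hr']
        exact Int.dvd_self_sub_emod
      have := dvd_add e1 e2
      rwa [show (m * k + r : ℤ) - l + ((q - m * p) - r) = (q - l) - m * (p - k) by ring] at this
    obtain ⟨c, hc⟩ := hdvd
    refine ⟨p - k, c, ?_⟩
    have hc' : ((q - l : ℤ) : ℝ) = m * (p - k) + n * c := by
      have : (q - l : ℤ) = m * (p - k) + n * c := by linarith
      rw [this]
      push_cast
      ring
    ext
    · rfl
    · show ((q - l : ℤ) : ℝ) / n = _
      rw [hc']
      push_cast
      field_simp
  · simp only
    rw [div_le_iff₀ hn0]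
    push_cast
    have : (0 : ℝ) ≤ k := Nat.cast_nonneg _
    linarith
  · simp only
    rw [div_le_iff₀ hn0]
    push_cast
    have : (0 : ℝ) ≤ l := Nat.cast_nonneg _
    linarith
  · simp only
    have hkl : (k : ℝ) + l + 1 ≤ 2 * j := by
      have : k + l + 1 ≤ 2 * j := hkl'
      exact_mod_cast this
    rw [← add_div, div_add_one hn0.ne', le_div_iff₀ hn0]
    have hnj : (n : ℝ) = 2 * j + 1 := by rw [hn]; push_cast; ring
    push_cast
    linarith

/-! ### Covolume of a triangular basis, and symmetries of the triangle -/

/-- A linear map of the plane with triangular matrix, of nonzero diagonal. -/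
noncomputable def triangularEquiv (a b c : ℝ) (ha : a ≠ 0) (hc : c ≠ 0) :
    (ℝ × ℝ) ≃ₗ[ℝ] (ℝ × ℝ) where
  toFun v := (v.1 * a, v.1 * b + v.2 * c)
  invFun v := (v.1 / a, (v.2 - v.1 / a * b) / c)
  map_add' v w := by ext <;> simp <;> ring
  map_smul' t v := by ext <;> simp <;> ring
  left_inv v := by ext <;> simp [ha, hc]
  right_inv v := by ext <;> simp [ha, hc]

theorem span_pair_lattice {a b c : ℝ} (ha : a ≠ 0) (hc : c ≠ 0) :
    IsPlaneLattice (Submodule.span ℤ {(a, b), (0, c)}) ∧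
      ZLattice.covolume (Submodule.span ℤ {(a, b), ((0 : ℝ), c)}) = |a * c| := by
  set B : Module.Basis (Fin 2) ℝ (ℝ × ℝ) :=
    (Module.Basis.finTwoProd ℝ).map (triangularEquiv a b c ha hc) with hB
  have h0 : B 0 = (a, b) := by simp [hB, triangularEquiv]
  have h1 : B 1 = (0, c) := by simp [hB, triangularEquiv]
  have hrange : Set.range B = {(a, b), ((0 : ℝ), c)} := by
    ext v
    simp [Fin.exists_fin_two, h0, h1, eq_comm]
  rw [← hrange]
  refine ⟨⟨inferInstance, inferInstance⟩, ?_⟩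
  rw [ZLattice.covolume_eq_measure_fundamentalDomain _ volume
    (ZSpan.isAddFundamentalDomain B volume),
    ZSpan.measureReal_fundamentalDomain B volume (Module.Basis.finTwoProd ℝ)]
  have hunit : ZSpan.fundamentalDomain (Module.Basis.finTwoProd ℝ) =
      Set.Ico (0 : ℝ) 1 ×ˢ Set.Ico (0 : ℝ) 1 := by
    ext v
    simp [ZSpan.mem_fundamentalDomain, Fin.forall_fin_two]
  have hvol : (volume : Measure (ℝ × ℝ)).real (Set.Ico (0 : ℝ) 1 ×ˢ Set.Ico (0 : ℝ) 1) = 1 := by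
    rw [measureReal_def, Measure.volume_eq_prod, Measure.prod_prod]
    simp
  have hdet : (Module.Basis.finTwoProd ℝ).det B = a * c := by
    rw [Module.Basis.det_apply, Matrix.det_fin_two]
    simp [Module.Basis.toMatrix_apply, h0, h1]
  rw [hunit, hvol, hdet, mul_one]

/-- The linear map permuting cyclically the edge directions of the standard triangle. -/
noncomputable def cyclicEquiv : (ℝ × ℝ) ≃L[ℝ] (ℝ × ℝ) :=
  LinearEquiv.toContinuousLinearEquiv
    { toFun := fun v => (v.2, -(v.2 + v.1))
      invFun := fun v => (-v.2 - v.1, v.1)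
      map_add' := fun v w => by ext <;> simp; ring
      map_smul' := fun t v => by ext <;> simp; ring
      left_inv := fun v => by ext <;> simp
      right_inv := fun v => by ext <;> simp }

theorem cyclicEquiv_apply (v : ℝ × ℝ) : cyclicEquiv v = (v.2, -(v.2 + v.1)) := rfl

theorem measurePreserving_cyclicEquiv :
    MeasurePreserving cyclicEquiv (volume : Measure (ℝ × ℝ)) volume := by
  have h1 : MeasurePreserving (Prod.swap : ℝ × ℝ → ℝ × ℝ) volume volume :=
    Measure.measurePreserving_swap
  have h2 : MeasurePreserving (fun v : ℝ × ℝ => (v.1, v.1 + v.2)) volume volume :=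
    measurePreserving_prod_add volume volume
  have h3 : MeasurePreserving (Prod.map id Neg.neg : ℝ × ℝ → ℝ × ℝ) volume volume :=
    (MeasurePreserving.id (volume : Measure ℝ)).prod (Measure.measurePreserving_neg volume)
  exact (h3.comp (h2.comp h1))

theorem measurePreserving_prodComm :
    MeasurePreserving (ContinuousLinearEquiv.prodComm ℝ ℝ ℝ) (volume : Measure (ℝ × ℝ)) volume :=
  Measure.measurePreserving_swap

theorem isFoldCovering_comap_prodComm {Λ : Submodule ℤ (ℝ × ℝ)} {j : ℕ}
    (hcov : IsFoldCovering j (latticeTranslates standardTriangle Λ)) :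
    IsFoldCovering j (latticeTranslates standardTriangle
      (ZLattice.comap ℝ Λ (ContinuousLinearEquiv.prodComm ℝ ℝ ℝ).toLinearMap)) := by
  rw [isFoldCovering_standardTriangle_iff] at hcov ⊢
  intro u
  rw [← Prod.swap_injective.encard_image]
  refine (hcov u.swap).trans (Set.encard_le_encard ?_)
  rintro v ⟨h1, h2, h3, h4⟩
  simp only [Prod.fst_swap, Prod.snd_swap] at h2 h3 h4
  exact ⟨v.swap, ⟨h1, h3, h2, by simp only [Prod.fst_swap, Prod.snd_swap]; linarith⟩, rfl⟩

/-- Together with u ↦ (u.2, 1 - u.1 - u.2), the map permutes cyclically the three inequalities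
saying that u lies in T + v. -/
theorem isFoldCovering_comap_cyclicEquiv {Λ : Submodule ℤ (ℝ × ℝ)} {j : ℕ}
    (hcov : IsFoldCovering j (latticeTranslates standardTriangle Λ)) :
    IsFoldCovering j (latticeTranslates standardTriangle
      (ZLattice.comap ℝ Λ cyclicEquiv.toLinearMap)) := by
  rw [isFoldCovering_standardTriangle_iff] at hcov ⊢
  intro u
  rw [← cyclicEquiv.injective.encard_image]
  refine (hcov (u.2, 1 - u.1 - u.2)).trans (Set.encard_le_encard ?_)
  rintro v ⟨h1, h2, h3, h4⟩
  simp only at h2 h3 h4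
  have hv : cyclicEquiv (-v.2 - v.1, v.1) = v := by
    rw [cyclicEquiv_apply]
    ext <;> simp
  refine ⟨(-v.2 - v.1, v.1), ⟨?_, ?_, ?_, ?_⟩, hv⟩
  · show cyclicEquiv (-v.2 - v.1, v.1) ∈ Λ
    rwa [hv]
  all_goals simp only; linarith

/-! ### Area and density -/

theorem standardTriangle_eq_setOf :
    standardTriangle = {p : ℝ × ℝ | 0 ≤ p.1 ∧ 0 ≤ p.2 ∧ p.1 + p.2 ≤ 1} :=
  Set.ext fun _ => mem_standardTriangle

theorem volume_standardTriangle : volume standardTriangle = ENNReal.ofReal (1 / 2) := by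
  have hm : MeasurableSet standardTriangle := by
    rw [standardTriangle_eq_setOf]
    exact (measurableSet_le measurable_const measurable_fst).inter
      ((measurableSet_le measurable_const measurable_snd).inter
        (measurableSet_le (measurable_fst.add measurable_snd) measurable_const))
  rw [Measure.volume_eq_prod, Measure.prod_apply hm]
  have hslice : ∀ x : ℝ, volume (Prod.mk x ⁻¹' standardTriangle) =
      (Set.Icc (0 : ℝ) 1).indicator (fun x => ENNReal.ofReal (1 - x)) x := by
    intro x
    by_cases hx : x ∈ Set.Icc (0 : ℝ) 1
    · rw [Set.indicator_of_mem hx]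
      have : Prod.mk x ⁻¹' standardTriangle = Set.Icc 0 (1 - x) := by
        ext y
        simp only [Set.mem_preimage, mem_standardTriangle, Set.mem_Icc]
        constructor
        · rintro ⟨-, h, h'⟩
          exact ⟨h, by linarith⟩
        · rintro ⟨h, h'⟩
          exact ⟨hx.1, h, by linarith⟩
      rw [this, Real.volume_Icc, sub_zero]
    · rw [Set.indicator_of_notMem hx]
      have : Prod.mk x ⁻¹' standardTriangle = ∅ := by
        ext y
        simp only [Set.mem_preimage, mem_standardTriangle, Set.mem_empty_iff_false, iff_false]
        rintro ⟨h, h', h''⟩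
        exact hx ⟨h, by linarith⟩
      rw [this, measure_empty]
  simp_rw [hslice]
  rw [lintegral_indicator measurableSet_Icc, ← ofReal_integral_eq_lintegral_ofReal]
  · congr 1
    rw [integral_Icc_eq_integral_Ioc, ← intervalIntegral.integral_of_le zero_le_one]
    rw [intervalIntegral.integral_sub (continuous_const.intervalIntegrable _ _)
      (continuous_id'.intervalIntegrable _ _)]
    simp
    norm_num
  · exact (continuous_const.sub continuous_id).integrableOn_Icc
  · filter_upwards [ae_restrict_mem measurableSet_Icc] with x hx
    simpa using hx.2

theorem latticeTranslate_subset_square_iff {Λ : Submodule ℤ (ℝ × ℝ)} (v : Λ) (l : ℝ) :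
    latticeTranslates standardTriangle Λ v ⊆ centeredSquare l ↔
      (v : ℝ × ℝ) ∈ Set.Icc (-l) (l - 1) ×ˢ Set.Icc (-l) (l - 1) := by
  constructor
  · intro h
    have h0 : (v : ℝ × ℝ) ∈ latticeTranslates standardTriangle Λ v :=
      mem_latticeTranslates_standardTriangle.mpr ⟨le_rfl, le_rfl, by linarith⟩
    have h1 : (v : ℝ × ℝ) + (1, 0) ∈ latticeTranslates standardTriangle Λ v :=
      mem_latticeTranslates_standardTriangle.mpr (by simp; linarith)
    have h2 : (v : ℝ × ℝ) + (0, 1) ∈ latticeTranslates standardTriangle Λ v :=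
      mem_latticeTranslates_standardTriangle.mpr (by simp; linarith)
    obtain ⟨⟨a1, -⟩, a2, -⟩ := h h0
    obtain ⟨⟨-, a3⟩, -⟩ := h h1
    obtain ⟨-, -, a4⟩ := h h2
    simp only [Prod.fst_add, Prod.snd_add] at a3 a4
    exact ⟨⟨a1, by linarith⟩, a2, by linarith⟩
  · rintro ⟨⟨a1, a2⟩, a3, a4⟩ u hu
    obtain ⟨h1, h2, h3⟩ := mem_latticeTranslates_standardTriangle.mp hu
    exact ⟨⟨by linarith, by linarith⟩, by linarith, by linarith⟩

theorem volume_latticeTranslate (K : Set (ℝ × ℝ)) {Λ : Submodule ℤ (ℝ × ℝ)} (v : Λ) :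
    volume (latticeTranslates K Λ v) = volume K := by
  unfold latticeTranslates
  rw [Set.image_add_right]
  exact measure_preimage_add_right _ _ _

theorem volume_Icc_prod_Icc {a b : ℝ} (h : a ≤ b) :
    volume (Set.Icc a b ×ˢ Set.Icc a b) = ENNReal.ofReal ((b - a) ^ 2) := by
  rw [Measure.volume_eq_prod, Measure.prod_prod, Real.volume_Icc,
    ← ENNReal.ofReal_mul (sub_nonneg.mpr h), sq]

theorem tendsto_square_ratio (c D : ℝ) (hD : D ≠ 0) :
    Tendsto (fun l : ℝ => (2 * l + c) ^ 2 / D * (1 / 2) / (2 * l) ^ 2) atTop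
      (nhds (1 / (2 * D))) := by
  have h1 : Tendsto (fun l : ℝ => (2 + c / l) ^ 2 / (8 * D)) atTop
      (nhds ((2 + 0) ^ 2 / (8 * D))) :=
    ((tendsto_const_nhds.add (tendsto_const_nhds.div_atTop tendsto_id)).pow 2).div_const _
  have h2 : ((2 : ℝ) + 0) ^ 2 / (8 * D) = 1 / (2 * D) := by
    field_simp
    norm_num
  rw [h2] at h1
  refine h1.congr' ?_
  filter_upwards [eventually_gt_atTop 0] with l hl
  field_simp
  ring

open scoped Pointwise in
-- The translates inside the square correspond to lattice points of a slightly smaller square. Their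
-- bounded fundamental cells cover that square shrunk by R and lie in it enlarged by R, so the
-- density is squeezed to an actual limit.
theorem lowerDensity_standardTriangle (Λ : Submodule ℤ (ℝ × ℝ)) [DiscreteTopology Λ]
    [IsZLattice ℝ Λ] :
    lowerDensity (latticeTranslates standardTriangle Λ) =
      ENNReal.ofReal (1 / (2 * ZLattice.covolume Λ)) := by
  classical
  have : VAddInvariantMeasure Λ (ℝ × ℝ) volume :=
    inferInstanceAs (VAddInvariantMeasure Λ.toAddSubgroup (ℝ × ℝ) volume)
  obtain ⟨F, hF, -, hFb, hFvol⟩ := exists_bounded_fundamentalDomain Λ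
  have hD := ZLattice.covolume_pos Λ
  set D := ZLattice.covolume Λ with hDdef
  obtain ⟨R, hR⟩ : ∃ R : ℝ, ∀ x ∈ F, |x.1| ≤ R ∧ |x.2| ≤ R := by
    obtain ⟨R, hR⟩ := hFb.exists_norm_le
    exact ⟨R, fun x hx => ⟨(norm_fst_le x).trans (hR x hx), (norm_snd_le x).trans (hR x hx)⟩⟩
  set box : ℝ → Set (ℝ × ℝ) := fun l => Set.Icc (-l) (l - 1) ×ˢ Set.Icc (-l) (l - 1) with hbox
  set N : ℝ → ENNReal := fun l => ∑' v : Λ, if (v : ℝ × ℝ) ∈ box l then 1 else 0 with hN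
  have hND : ∀ l, N l * ENNReal.ofReal D =
      ∑' v : Λ, if (v : ℝ × ℝ) ∈ box l then ENNReal.ofReal D else 0 := by
    intro l
    rw [hN, ← ENNReal.tsum_mul_right]
    simp only [ite_mul, one_mul, zero_mul]
  have hdens : ∀ l : ℝ, 0 < l → lowerDensityOn (latticeTranslates standardTriangle Λ)
      (centeredSquare l) = N l * ENNReal.ofReal (1 / 2) / ENNReal.ofReal ((2 * l) ^ 2) := by
    intro l hl
    unfold lowerDensityOn
    have hsq : volume (centeredSquare l) = ENNReal.ofReal ((2 * l) ^ 2) := by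
      unfold centeredSquare
      rw [volume_Icc_prod_Icc (by linarith), sub_neg_eq_add, ← two_mul]
    rw [hsq, hN, ← ENNReal.tsum_mul_right]
    congr 1
    refine tsum_congr fun v => ?_
    rw [volume_latticeTranslate, volume_standardTriangle]
    by_cases hv : (v : ℝ × ℝ) ∈ box l
    · rw [if_pos ((latticeTranslate_subset_square_iff v l).mpr hv), if_pos hv, one_mul]
    · rw [if_neg (fun h => hv ((latticeTranslate_subset_square_iff v l).mp h)), if_neg hv, zero_mul]
  have hmem : ∀ (v : Λ) (y : ℝ × ℝ), y ∈ v +ᵥ F →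
      |y.1 - (v : ℝ × ℝ).1| ≤ R ∧ |y.2 - (v : ℝ × ℝ).2| ≤ R := by
    rintro v _ ⟨x, hx, rfl⟩
    have : v +ᵥ x = (v : ℝ × ℝ) + x := rfl
    simpa [this] using hR x hx
  have hupper : ∀ l : ℝ, |R| + 1 < l →
      N l * ENNReal.ofReal D ≤ ENNReal.ofReal ((2 * l + (2 * R - 1)) ^ 2) := by
    intro l hl
    have hRR := neg_abs_le R
    set t : Set (ℝ × ℝ) := Set.Icc (-l - R) (l - 1 + R) ×ˢ Set.Icc (-l - R) (l - 1 + R) with ht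
    have hvol : volume t = ENNReal.ofReal ((2 * l + (2 * R - 1)) ^ 2) := by
      rw [ht, volume_Icc_prod_Icc (by linarith [le_abs_self R])]
      congr 2
      ring
    rw [hND, ← hvol, hF.measure_eq_tsum' t]
    refine ENNReal.tsum_le_tsum fun v => ?_
    split_ifs with hv
    · obtain ⟨⟨a1, a2⟩, a3, a4⟩ := hv
      have hsub : v +ᵥ F ⊆ t := by
        intro y hy
        obtain ⟨h1, h2⟩ := hmem v y hy
        rw [abs_le] at h1 h2
        exact ⟨⟨by linarith, by linarith⟩, by linarith, by linarith⟩
      rw [Set.inter_eq_self_of_subset_right hsub, measure_vadd, hFvol]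
    · exact zero_le
  have hlower : ∀ l : ℝ, |R| + 1 < l →
      ENNReal.ofReal ((2 * l + (-2 * R - 1)) ^ 2) ≤ N l * ENNReal.ofReal D := by
    intro l hl
    have hRR := neg_abs_le R
    set t : Set (ℝ × ℝ) := Set.Icc (-l + R) (l - 1 - R) ×ˢ Set.Icc (-l + R) (l - 1 - R) with ht
    have hvol : volume t = ENNReal.ofReal ((2 * l + (-2 * R - 1)) ^ 2) := by
      rw [ht, volume_Icc_prod_Icc (by linarith [le_abs_self R, abs_nonneg R])]
      congr 2
      ring
    rw [hND, ← hvol, hF.measure_eq_tsum' t]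
    refine ENNReal.tsum_le_tsum fun v => ?_
    split_ifs with hv
    · calc volume (t ∩ (v +ᵥ F)) ≤ volume (v +ᵥ F) := measure_mono Set.inter_subset_right
        _ = ENNReal.ofReal D := by rw [measure_vadd, hFvol]
    · have : t ∩ (v +ᵥ F) = ∅ := by
        rw [Set.eq_empty_iff_forall_notMem]
        rintro y ⟨⟨⟨a1, a2⟩, a3, a4⟩, hy⟩
        obtain ⟨h1, h2⟩ := hmem v y hy
        rw [abs_le] at h1 h2
        exact hv ⟨⟨by linarith, by linarith⟩, by linarith, by linarith⟩
      rw [this, measure_empty]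
  have hD0 : ENNReal.ofReal D ≠ 0 := by simpa using hD
  have hlim : Tendsto (fun l : ℝ => lowerDensityOn (latticeTranslates standardTriangle Λ)
      (centeredSquare l)) atTop (nhds (ENNReal.ofReal (1 / (2 * D)))) := by
    have hconv : ∀ c l : ℝ, 0 < l →
        ENNReal.ofReal ((2 * l + c) ^ 2 / D * (1 / 2) / (2 * l) ^ 2) =
        ENNReal.ofReal ((2 * l + c) ^ 2) / ENNReal.ofReal D * ENNReal.ofReal (1 / 2) /
          ENNReal.ofReal ((2 * l) ^ 2) := by
      intro c l hl
      rw [ENNReal.ofReal_div_of_pos (by positivity), ENNReal.ofReal_mul (by positivity),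
        ENNReal.ofReal_div_of_pos hD]
    refine tendsto_of_tendsto_of_tendsto_of_le_of_le'
      (ENNReal.tendsto_ofReal (tendsto_square_ratio (-2 * R - 1) D hD.ne'))
      (ENNReal.tendsto_ofReal (tendsto_square_ratio (2 * R - 1) D hD.ne')) ?_ ?_
    · filter_upwards [eventually_gt_atTop (|R| + 1), eventually_gt_atTop 0] with l hl hl0
      rw [hconv _ _ hl0, hdens l hl0]
      gcongr
      exact ENNReal.div_le_of_le_mul (hlower l hl)
    · filter_upwards [eventually_gt_atTop (|R| + 1), eventually_gt_atTop 0] with l hl hl0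
      rw [hconv _ _ hl0, hdens l hl0]
      gcongr
      exact (ENNReal.le_div_iff_mul_le (Or.inl hD0) (Or.inl ENNReal.ofReal_ne_top)).mpr
        (hupper l hl)
  exact hlim.liminf_eq

/-! ### Generators of extremal lattices and the conclusion -/

theorem mem_span_pair_iff (x y : ℝ) (v : ℝ × ℝ) :
    v ∈ Submodule.span ℤ {(x, y), ((0 : ℝ), (1 : ℝ))} ↔
      ∃ a b : ℤ, v = (a * x, a * y + b) := by
  rw [Submodule.mem_span_pair]
  refine exists_congr fun a => exists_congr fun b => ?_
  simp [eq_comm]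

/-- A vector w with abscissa 1/n and the vertical sublattice generate Λ; the covolume then makes the
vertical generator (0, ±1). Coprimality is read off as Bézout identities from the vectors in `e2`
and `e3`. -/
theorem exists_coprime_generator {Λ : Submodule ℤ (ℝ × ℝ)} [DiscreteTopology Λ] [IsZLattice ℝ Λ]
    {n : ℕ} (hn : 0 < n) (hD : ZLattice.covolume Λ = 1 / n)
    (h1 : ∀ v ∈ Λ, ∃ k : ℤ, n * v.1 = k) (h2 : ∀ v ∈ Λ, ∃ k : ℤ, n * v.2 = k)
    (e1 : ∃ v ∈ Λ, v.1 = 1 / n) (e2 : ∃ v ∈ Λ, v.2 = 1 / n) (e3 : ∃ v ∈ Λ, v.1 + v.2 = -(1 / n)) :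
    ∃ m : ℕ, 1 ≤ m ∧ m ≤ n ∧ Nat.gcd m n = 1 ∧ Nat.gcd (m + 1) n = 1 ∧
      Λ = Submodule.span ℤ {(1 / (n : ℝ), (m : ℝ) / n), ((0 : ℝ), (1 : ℝ))} := by
  have hn0 : (0 : ℝ) < n := by exact_mod_cast hn
  obtain ⟨w, hw, hw1⟩ := e1
  obtain ⟨m₀, hm₀⟩ := h2 w hw
  have hwe : w = (1 / (n : ℝ), (m₀ : ℝ) / n) := by
    ext
    · exact hw1
    · simp only
      rw [← hm₀]
      field_simp
  set K : AddSubgroup ℤ :=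
    { carrier := {k | ((0 : ℝ), (k : ℝ) / n) ∈ Λ}
      add_mem' := by
        intro a b ha hb
        have := Λ.add_mem ha hb
        simpa [add_div] using this
      zero_mem' := by
        have := Λ.zero_mem
        simpa [Prod.zero_eq_mk] using this
      neg_mem' := by
        intro a ha
        have := Λ.neg_mem ha
        simpa [neg_div] using this } with hK
  have hKmem : ∀ k : ℤ, k ∈ K ↔ ((0 : ℝ), (k : ℝ) / n) ∈ Λ := fun k => Iff.rfl
  obtain ⟨h, hh⟩ := Int.subgroup_cyclic K
  rw [← AddSubgroup.zmultiples_eq_closure] at hh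
  have hspan : Λ = Submodule.span ℤ {(1 / (n : ℝ), (m₀ : ℝ) / n), ((0 : ℝ), (h : ℝ) / n)} := by
    apply le_antisymm
    · intro v hv
      obtain ⟨k, hk⟩ := h1 v hv
      have hu : v - k • w ∈ Λ := Λ.sub_mem hv (Λ.smul_mem k hw)
      obtain ⟨l, hl⟩ := h2 _ hu
      have hueq : v - k • w = ((0 : ℝ), (l : ℝ) / n) := by
        ext
        · have hfst : (v - k • w).1 = v.1 - k * w.1 := by simp
          simp only
          rw [hfst, hw1, ← hk]
          field_simp
          ring
        · simp only
          rw [← hl]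
          field_simp
      rw [hueq] at hu
      have hlK : l ∈ K := (hKmem l).mpr hu
      rw [hh, AddSubgroup.mem_zmultiples_iff] at hlK
      obtain ⟨c, hc⟩ := hlK
      rw [Submodule.mem_span_pair]
      refine ⟨k, c, ?_⟩
      rw [← hwe, sub_eq_iff_eq_add'.mp hueq, ← hc]
      simp [mul_div_assoc]
    · rw [Submodule.span_le]
      rintro v (rfl | rfl)
      · rwa [← hwe]
      · refine (hKmem h).mp ?_
        rw [hh]
        exact AddSubgroup.mem_zmultiples h
  -- Otherwise Λ would lie on the line y = m₀x and not span the plane.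
  have hh0 : (h : ℝ) / n ≠ 0 := by
    intro h0
    have hle : Submodule.span ℝ (Λ : Set (ℝ × ℝ)) ≤
        LinearMap.ker (LinearMap.snd ℝ ℝ ℝ - (m₀ : ℝ) • LinearMap.fst ℝ ℝ ℝ) := by
      rw [Submodule.span_le]
      intro v hv
      rw [SetLike.mem_coe, hspan, h0, Submodule.mem_span_pair] at hv
      obtain ⟨a, b, rfl⟩ := hv
      simp
      ring
    rw [IsZLattice.span_top] at hle
    have := hle (Submodule.mem_top : ((0 : ℝ), (1 : ℝ)) ∈ ⊤)
    simp at this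
  have hcov := (span_pair_lattice (a := 1 / (n : ℝ)) (b := (m₀ : ℝ) / n)
    (by positivity) hh0).2
  rw [← hspan, hD] at hcov
  have habs : |(h : ℝ) / n| = 1 := by
    rw [abs_mul, abs_of_pos (by positivity : 0 < 1 / (n : ℝ))] at hcov
    have := mul_left_cancel₀ (by positivity : 1 / (n : ℝ) ≠ 0)
      ((mul_one _).trans hcov)
    exact this.symm
  have h01 : ((0 : ℝ), (1 : ℝ)) ∈ Λ := by
    have hm : ((0 : ℝ), (h : ℝ) / n) ∈ Λ := by
      rw [hspan]
      exact Submodule.subset_span (by simp)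
    rcases (abs_eq zero_le_one).mp habs with h' | h'
    · rwa [h'] at hm
    · rw [h'] at hm
      simpa using Λ.neg_mem hm
  -- Reducing m₀ - 1 and adding 1 back selects the representative in 1, …, n rather than 0, …, n -
  -- 1.
  obtain ⟨m, hm1, hmn, c, hmc⟩ : ∃ m : ℕ, 1 ≤ m ∧ m ≤ n ∧ ∃ c : ℤ, (m : ℤ) = m₀ + c * n := by
    have hpos : 0 ≤ (m₀ - 1) % (n : ℤ) := Int.emod_nonneg _ (by omega)
    have hlt : (m₀ - 1) % (n : ℤ) < n := Int.emod_lt_of_pos _ (by omega)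
    refine ⟨((m₀ - 1) % (n : ℤ)).toNat + 1, by omega, by omega, -((m₀ - 1) / (n : ℤ)), ?_⟩
    push_cast
    rw [Int.toNat_of_nonneg hpos, Int.emod_def]
    ring
  have hmc' : (m : ℝ) / n = (m₀ : ℝ) / n + c := by
    have : (m : ℝ) = m₀ + c * n := by exact_mod_cast hmc
    rw [this]
    field_simp
  have hfinal : Λ = Submodule.span ℤ {(1 / (n : ℝ), (m : ℝ) / n), ((0 : ℝ), (1 : ℝ))} := by
    apply le_antisymm
    · rw [hspan, Submodule.span_le]
      rintro v (rfl | rfl)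
      · rw [SetLike.mem_coe, mem_span_pair_iff]
        exact ⟨1, -c, by rw [hmc']; ext <;> simp⟩
      · rw [SetLike.mem_coe, mem_span_pair_iff]
        rcases (abs_eq zero_le_one).mp habs with h' | h'
        · exact ⟨0, 1, by rw [h']; simp⟩
        · exact ⟨0, -1, by rw [h']; simp⟩
    · rw [Submodule.span_le]
      rintro v (rfl | rfl)
      · have := Λ.add_mem hw (Λ.smul_mem c h01)
        rw [hwe] at this
        rw [hmc']
        simpa using this
      · exact h01
  refine ⟨m, hm1, hmn, ?_, ?_, hfinal⟩
  · obtain ⟨v, hv, hv2⟩ := e2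
    rw [hfinal, mem_span_pair_iff] at hv
    obtain ⟨a, b, rfl⟩ := hv
    simp only at hv2
    refine Nat.isCoprime_iff_coprime.mp ⟨a, b, ?_⟩
    have : (a : ℝ) * m + b * n = 1 := by
      field_simp at hv2
      linarith
    exact_mod_cast this
  · obtain ⟨v, hv, hv3⟩ := e3
    rw [hfinal, mem_span_pair_iff] at hv
    obtain ⟨a, b, rfl⟩ := hv
    simp only at hv3
    refine Nat.isCoprime_iff_coprime.mp ⟨-a, -b, ?_⟩
    have : -(a : ℝ) * (m + 1) + -b * n = 1 := by
      field_simp at hv3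
      linarith
    push_cast
    exact_mod_cast this

/-- The swap and the cyclic map preserve area and the covering property, so the structure found for
first coordinates transfers to y and to -(x + y). -/
theorem exists_generator_of_extremal {Λ : Submodule ℤ (ℝ × ℝ)} [DiscreteTopology Λ]
    [IsZLattice ℝ Λ] {j : ℕ} (hj : 1 ≤ j)
    (hcov : IsFoldCovering j (latticeTranslates standardTriangle Λ))
    (hD : ZLattice.covolume Λ = 1 / (2 * j + 1 : ℕ)) :
    ∃ m : ℕ, 1 ≤ m ∧ m ≤ 2 * j + 1 ∧ Nat.gcd m (2 * j + 1) = 1 ∧ Nat.gcd (m + 1) (2 * j + 1) = 1 ∧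
      Λ = Submodule.span ℤ
        {(1 / ((2 * j + 1 : ℕ) : ℝ), (m : ℝ) / (2 * j + 1 : ℕ)), ((0 : ℝ), (1 : ℝ))} := by
  have hcov₂ := isFoldCovering_comap_prodComm hcov
  have hcov₃ := isFoldCovering_comap_cyclicEquiv hcov
  have hD₂ := (ZLattice.covolume_comap Λ volume volume measurePreserving_prodComm).trans hD
  have hD₃ := (ZLattice.covolume_comap Λ volume volume measurePreserving_cyclicEquiv).trans hD
  obtain ⟨-, -, e1⟩ := extremal_structure hj hcov hD
  obtain ⟨-, -, v₂, hv₂, hv₂'⟩ := extremal_structure hj hcov₂ hD₂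
  obtain ⟨-, -, v₃, hv₃, hv₃'⟩ := extremal_structure hj hcov₃ hD₃
  have e2 : ∃ v ∈ Λ, v.2 = 1 / ((2 * j + 1 : ℕ) : ℝ) := ⟨v₂.swap, hv₂, hv₂'⟩
  have e3 : ∃ v ∈ Λ, v.1 + v.2 = -(1 / ((2 * j + 1 : ℕ) : ℝ)) := by
    refine ⟨cyclicEquiv v₃, hv₃, ?_⟩
    rw [cyclicEquiv_apply, ← hv₃']
    ring
  have e1' : ∃ w ∈ ZLattice.comap ℝ Λ (ContinuousLinearEquiv.prodComm ℝ ℝ ℝ).toLinearMap,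
      w.2 = 1 / ((2 * j + 1 : ℕ) : ℝ) := by
    obtain ⟨v, hv, hv'⟩ := e1
    refine ⟨v.swap, ?_, hv'⟩
    show v.swap.swap ∈ Λ
    rwa [Prod.swap_swap]
  refine exists_coprime_generator (by omega) hD
    (fun v hv => fst_integral_of_extremal hj hcov hD e2 hv) (fun v hv => ?_) e1 e2 e3
  have hv' : v.swap ∈ ZLattice.comap ℝ Λ (ContinuousLinearEquiv.prodComm ℝ ℝ ℝ).toLinearMap := by
    show v.swap.swap ∈ Λ
    rwa [Prod.swap_swap]
  exact fst_integral_of_extremal hj hcov₂ hD₂ e1' hv'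

theorem extremal_of_generator {j m : ℕ} (h1 : Nat.gcd m (2 * j + 1) = 1)
    (h2 : Nat.gcd (m + 1) (2 * j + 1) = 1) {Λ : Submodule ℤ (ℝ × ℝ)}
    (hΛ : Λ = Submodule.span ℤ
        {(1 / ((2 * j + 1 : ℕ) : ℝ), (m : ℝ) / (2 * j + 1 : ℕ)), ((0 : ℝ), (1 : ℝ))}) :
    IsFoldLatticeCovering j standardTriangle Λ ∧
      ZLattice.covolume Λ = 1 / (2 * j + 1 : ℕ) := by
  obtain ⟨hL, hD⟩ := span_pair_lattice (a := 1 / ((2 * j + 1 : ℕ) : ℝ))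
    (b := (m : ℝ) / (2 * j + 1 : ℕ)) (by positivity) (one_ne_zero (α := ℝ))
  rw [mul_one, abs_of_pos (by positivity)] at hD
  rw [← hΛ] at hL hD
  refine ⟨⟨hL, isFoldCovering_of_coprime h1 h2 fun v => ?_⟩, hD⟩
  rw [hΛ, mem_span_pair_iff]
  simp only [mul_one_div]

theorem lowerDensity_le_iff_covolume {Λ : Submodule ℤ (ℝ × ℝ)} [DiscreteTopology Λ]
    [IsZLattice ℝ Λ] {n : ℕ} (hn : 0 < n) :
    ENNReal.ofReal ((n : ℝ) / 2) ≤ lowerDensity (latticeTranslates standardTriangle Λ) ↔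
      ZLattice.covolume Λ ≤ 1 / n := by
  have hn0 : (0 : ℝ) < n := by exact_mod_cast hn
  have hD := ZLattice.covolume_pos Λ
  rw [lowerDensity_standardTriangle, ENNReal.ofReal_le_ofReal_iff (by positivity),
    div_le_div_iff₀ two_pos (by positivity), le_div_iff₀ hn0]
  constructor <;> intro h <;> linarith

theorem lowerDensity_eq_iff_covolume {Λ : Submodule ℤ (ℝ × ℝ)} [DiscreteTopology Λ]
    [IsZLattice ℝ Λ] {n : ℕ} (hn : 0 < n) :
    lowerDensity (latticeTranslates standardTriangle Λ) = ENNReal.ofReal ((n : ℝ) / 2) ↔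
      ZLattice.covolume Λ = 1 / n := by
  have hn0 : (0 : ℝ) < n := by exact_mod_cast hn
  have hD := ZLattice.covolume_pos Λ
  rw [lowerDensity_standardTriangle, ENNReal.ofReal_eq_ofReal_iff (by positivity) (by positivity),
    div_eq_div_iff (by positivity) two_ne_zero, eq_div_iff hn0.ne']
  constructor <;> intro h <;> linarith

theorem latticeCoveringDensity_standardTriangle {j : ℕ} (hj : 1 ≤ j) :
    latticeCoveringDensity j standardTriangle = ENNReal.ofReal (((2 * j + 1 : ℕ) : ℝ) / 2) := by
  apply le_antisymm
  -- The bound is attained with m = 1, admissible because 2j + 1 is odd.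
  · have h2 : Nat.gcd (1 + 1) (2 * j + 1) = 1 := by
      rw [Nat.gcd_rec]
      simp [Nat.add_mod]
    obtain ⟨hL, hD⟩ := extremal_of_generator (j := j) (m := 1) (Nat.gcd_one_left _) h2 rfl
    obtain ⟨h, h'⟩ := hL.1
    exact sInf_le ⟨_, hL, ((lowerDensity_eq_iff_covolume (by omega)).mpr hD).symm⟩
  · refine le_sInf ?_
    rintro _ ⟨Λ, ⟨⟨h, h'⟩, hcov⟩, rfl⟩
    exact (lowerDensity_le_iff_covolume (by omega)).mpr (covolume_le_of_covering hj hcov)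

theorem theorem3 (j : ℕ) (hj : 1 ≤ j) (Λ : Submodule ℤ (ℝ × ℝ)) :
    Λ ∈ optimalCoveringLattices j standardTriangle ↔
      ∃ m : ℕ, 1 ≤ m ∧ m ≤ 2 * j + 1 ∧
        Nat.gcd m (2 * j + 1) = 1 ∧ Nat.gcd (m + 1) (2 * j + 1) = 1 ∧
        Λ = Submodule.span ℤ
          {((1 : ℝ) / (2 * (j : ℝ) + 1), (m : ℝ) / (2 * (j : ℝ) + 1)), ((0 : ℝ), (1 : ℝ))} := by
  have hcast : (2 * (j : ℝ) + 1) = ((2 * j + 1 : ℕ) : ℝ) := by push_cast; ring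
  rw [hcast]
  constructor
  · rintro ⟨⟨⟨h, h'⟩, hcov⟩, hdens⟩
    rw [latticeCoveringDensity_standardTriangle hj,
      lowerDensity_eq_iff_covolume (by omega)] at hdens
    exact exists_generator_of_extremal hj hcov hdens
  · rintro ⟨m, -, -, h1, h2, hΛ⟩
    obtain ⟨hL, hD⟩ := extremal_of_generator h1 h2 hΛ
    obtain ⟨h, h'⟩ := hL.1
    exact ⟨hL, by rw [latticeCoveringDensity_standardTriangle hj,
      lowerDensity_eq_iff_covolume (by omega), hD]⟩
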